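/- Throughout, manifolds are smooth, Hausdorff, finite-dimensional and without boundary. A singular semi-Riemannian manifold $(M,g)$ is a manifold $M$ with a smooth symmetric $(0,2)$-tensor field $g=\langle\cdot,\cdot\rangle$, which may degenerate and change signature. For $p\in M$ let $(T_pM)^{\bullet}=\{g_p(x,\cdot): x\in T_pM\}\subseteq T_p^*M$, with the inner product $\langle\langle g_p(x,\cdot),g_p(y,\cdot)\rangle\rangle_\bullet:=g_p(x,y)$, and let $\mathcal A^{\bullet}(M)$ be the set of smooth $1$-forms $\omega$ on $M$ with $\omega_p\in (T_pM)^{\bullet}$ for every $p\in M$. For smooth vector fields $X,Y,Z$ let $$\mathcal K(X,Y,Z)=\tfrac12\{X\langle Y,Z\rangle+Y\langle Z,X\rangle-Z\langle X,Y\rangle-\langle X,[Y,Z]\rangle+\langle Y,[Z,X]\rangle+\langle Z,[X,Y]\rangle\},$$ and let $\nabla^\flat_XY$ be the $1$-form $Z\mapsto\mathcal K(X,Y,Z)$. If $\nabla^\flat_XY\in\mathcal A^\bullet(M)$ for all smooth $X,Y$, then for $\omega\in\mathcal A^{\bullet}(M)$ put $$(\nabla_X\omega)(Y)=X(\omega(Y))-\langle\langle\nabla^\flat_XY,\omega\rangle\rangle_\bullet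 ,$$ a $1$-form on the (open and dense) set of points near which the signature of $g$ is constant; one writes $\nabla_X\omega\in\mathcal A^\bullet(M)$ if this $1$-form extends to an element of $\mathcal A^\bullet(M)$. The manifold $(M,g)$ is called semi-regular if $\nabla^\flat_XY\in\mathcal A^\bullet(M)$ and $\nabla_Z(\nabla^\flat_XY)\in\mathcal A^\bullet(M)$ for all smooth vector fields $X,Y,Z$. **Theorem.** Let $(B,g_B)$ be a non-degenerate semi-Riemannian manifold, let $(F_j,g_{F_j})$, $1\le j\le l$, be semi-regular semi-Riemannian manifolds, and let $f_j\in C^\infty(B)$, $1\le j\le l$, be smooth functions (which may have zeros). Then the multiply warped product $$\Bigl(B\times F_1\times\cdots\times F_l,\ \pi_B^*(g_B)+\sum_{j=1}^l (f_j\circ\pi_B)^2\,\pi_{F_j}^*(g_{F_j})\Bigr)$$ is a semi-regular semi-Riemannian manifold. -/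

import Mathlib

open scoped Manifold ContDiff Topology Bundle

namespace SingularGeometry

noncomputable section

section PiManifold

/-- A finite product of smooth manifolds is a smooth manifold, for the product atlas. -/
instance isManifold_pi {l : ℕ} {E : Fin l → Type*}
    [∀ j, NormedAddCommGroup (E j)] [∀ j, NormedSpace ℝ (E j)]
    {H : Fin l → Type*} [∀ j, TopologicalSpace (H j)] (I : ∀ j, ModelWithCorners ℝ (E j) (H j))
    (M : Fin l → Type*) [∀ j, TopologicalSpace (M j)] [∀ j, ChartedSpace (H j) (M j)]
    [∀ j, IsManifold (I j) ∞ (M j)] :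
    IsManifold (ModelWithCorners.pi I) ∞ (∀ j, M j) := by
  apply isManifold_of_contDiffOn
  rintro _ _ ⟨e, he, rfl⟩ ⟨e', he', rfl⟩
  rw [contDiffOn_pi]
  intro j
  have hj := ((contDiffGroupoid ∞ (I j)).compatible (he j trivial) (he' j trivial)).1
  simp only [contDiffPregroupoid] at hj
  refine hj.comp (f := fun x : (∀ j, E j) => x j) 
    (ContinuousLinearMap.proj (R := ℝ) (φ := E) j).contDiff.contDiffOn ?_
  rintro x ⟨hx, ⟨y, rfl⟩⟩
  refine ⟨?_, ⟨y j, rfl⟩⟩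
  have h1 := hx.1 j trivial
  have h2 := hx.2 j trivial
  exact ⟨h1, h2⟩

end PiManifold

variable {E : Type*} [NormedAddCommGroup E] [NormedSpace ℝ E]
  {H : Type*} [TopologicalSpace H] {I : ModelWithCorners ℝ E H}
  {M : Type*} [TopologicalSpace M] [ChartedSpace H M]

/-- A (not necessarily continuous) field of bilinear forms on the tangent spaces of `M`. -/
abbrev FormField (I : ModelWithCorners ℝ E H) (M : Type*) [TopologicalSpace M]
    [ChartedSpace H M] : Type _ :=
  ∀ p : M, TangentSpace I p →L[ℝ] TangentSpace I p →L[ℝ] ℝ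

/-- A (not necessarily continuous) field of covectors on `M`. -/
abbrev CovectorField (I : ModelWithCorners ℝ E H) (M : Type*) [TopologicalSpace M]
    [ChartedSpace H M] : Type _ :=
  ∀ p : M, TangentSpace I p →L[ℝ] ℝ

section Smooth

variable [IsManifold I ∞ M]

/-- `X` is a smooth vector field. -/
def IsSmoothVectorField (X : ∀ p : M, TangentSpace I p) : Prop :=
  ContMDiff I I.tangent ∞ (fun p => (⟨p, X p⟩ : TangentBundle I M))

/-- `η` is a smooth `1`-form. -/
def IsSmoothOneForm (η : CovectorField I M) : Prop :=
  ContMDiff I (I.prod 𝓘(ℝ, E →L[ℝ] ℝ)) ∞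
    (fun p => Bundle.TotalSpace.mk' (E →L[ℝ] ℝ) (E := fun p : M => TangentSpace I p →L[ℝ] ℝ)
      p (η p))

/-- `g` is a singular semi-Riemannian metric: a smooth symmetric `(0,2)`-tensor field, which may
degenerate and change signature. -/
structure IsSingularMetric (g : FormField I M) : Prop where
  symm : ∀ (p : M) (x y : TangentSpace I p), g p x y = g p y x
  smooth : ContMDiff I (I.prod 𝓘(ℝ, E →L[ℝ] E →L[ℝ] ℝ)) ∞
    (fun p => Bundle.TotalSpace.mk' (E →L[ℝ] E →L[ℝ] ℝ)
      (E := fun p : M => TangentSpace I p →L[ℝ] TangentSpace I p →L[ℝ] ℝ) p (g p))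

end Smooth

/-- `g` is non-degenerate at every point. -/
def IsNondegenerate (g : FormField I M) : Prop :=
  ∀ (p : M) (x : TangentSpace I p), (∀ y : TangentSpace I p, g p x y = 0) → x = 0

/-- The quadratic form of `g` on the tangent space at `p`. -/
def quadForm (g : FormField I M) (p : M) : QuadraticForm ℝ (TangentSpace I p) :=
  LinearMap.BilinMap.toQuadraticMap (g p).toBilinForm

/-- The signature of `g` is constant in a neighbourhood of `p`. -/
def ConstSignatureAt (g : FormField I M) (p : M) : Prop :=
  ∀ᶠ q in 𝓝 p, sigPos (quadForm g q) = sigPos (quadForm g p) ∧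
    sigNeg (quadForm g q) = sigNeg (quadForm g p)

/-- The space `(T_pM)^•` of covectors at `p` of the form `g_p(x, ·)` with `x ∈ T_pM`. -/
def radicalAnnihilator (g : FormField I M) (p : M) : Submodule ℝ (TangentSpace I p →L[ℝ] ℝ) :=
  LinearMap.range (g p).toLinearMap

/-- `η ∈ 𝒜^•(M)`: a smooth `1`-form with `η_p ∈ (T_pM)^•` for every `p`. -/
def IsAnnihilatorForm [IsManifold I ∞ M] (g : FormField I M) (η : CovectorField I M) : Prop :=
  IsSmoothOneForm η ∧ ∀ p, η p ∈ radicalAnnihilator g p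

open Classical in
/-- The inner product `⟪α, β⟫_•` on `(T_pM)^•`: its value is `g_p(x, y)` if `α = g_p(x, ·)` and
`β = g_p(y, ·)`. Covectors outside `(T_pM)^•` get the value `0`, which is never used. -/
def coInner (g : FormField I M) (p : M) (α β : TangentSpace I p →L[ℝ] ℝ) : ℝ :=
  if h : (∃ x, g p x = α) ∧ (∃ y, g p y = β) then g p h.1.choose h.2.choose else 0

/-- The inner product on `(T_pM)^•` does not depend on the chosen vectors. -/
theorem coInner_flat (g : FormField I M) (p : M)
    (hg : ∀ x y : TangentSpace I p, g p x y = g p y x) (x y : TangentSpace I p) :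
    coInner g p (g p x) (g p y) = g p x y := by
  have h : (∃ x', g p x' = g p x) ∧ (∃ y', g p y' = g p y) := ⟨⟨x, rfl⟩, ⟨y, rfl⟩⟩
  rw [coInner, dif_pos h, h.1.choose_spec, hg, h.2.choose_spec, hg]

/-- The derivative `X(h)` of a function along a vector field. -/
def dirDeriv (X : ∀ p : M, TangentSpace I p) (h : M → ℝ) (p : M) : ℝ :=
  mvfderiv I h p (X p)

/-- The Koszul form `𝒦(X, Y, Z)`. -/
def koszul (g : FormField I M) (X Y Z : ∀ p : M, TangentSpace I p) (p : M) : ℝ :=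
  (1 / 2 : ℝ) *
    (dirDeriv X (fun q => g q (Y q) (Z q)) p + dirDeriv Y (fun q => g q (Z q) (X q)) p
      - dirDeriv Z (fun q => g q (X q) (Y q)) p
      - g p (X p) (VectorField.mlieBracket I Y Z p)
      + g p (Y p) (VectorField.mlieBracket I Z X p)
      + g p (Z p) (VectorField.mlieBracket I X Y p))

section CovDeriv

variable [IsManifold I ∞ M]

theorem mdiffAt_pairing {g : FormField I M} (hg : IsSingularMetric g)
    {Y Z : ∀ p : M, TangentSpace I p} {p : M}
    (hY : MDifferentiableAt I I.tangent (fun q => (⟨q, Y q⟩ : TangentBundle I M)) p)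
    (hZ : MDifferentiableAt I I.tangent (fun q => (⟨q, Z q⟩ : TangentBundle I M)) p) :
    MDifferentiableAt I 𝓘(ℝ, ℝ) (fun q => g q (Y q) (Z q)) p := by
  have h : MDifferentiableAt I (I.prod 𝓘(ℝ))
      (fun m => Bundle.TotalSpace.mk' ℝ (E := Bundle.Trivial M ℝ) m (g m (Y m) (Z m))) p := by
    apply MDifferentiableAt.clm_bundle_apply₂ (F₁ := E) (F₂ := E)
    · exact hg.smooth.mdifferentiableAt (by simp)
    · exact hY
    · exact hZ
  simp only [mdifferentiableAt_totalSpace] at h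
  exact h.2

variable [FiniteDimensional ℝ E]

/-- The Koszul form is tensorial in its last argument. -/
theorem koszul_tensorialAt {g : FormField I M} (hg : IsSingularMetric g)
    {X Y : ∀ p : M, TangentSpace I p} (hX : IsSmoothVectorField X) (hY : IsSmoothVectorField Y)
    (p : M) : TensorialAt I E (fun Z => koszul g X Y Z p) p where
  smul := by
    intro f Z hf hZ
    have hX' := (hX p).mdifferentiableAt (by simp)
    have hY' := (hY p).mdifferentiableAt (by simp)
    have e1 : (fun q => g q (Y q) ((f • Z) q)) = f * fun q => g q (Y q) (Z q) := by
      ext q; simp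
    have e2 : (fun q => g q ((f • Z) q) (X q)) = f * fun q => g q (Z q) (X q) := by
      ext q; simp
    have h1 := mdiffAt_pairing hg hY' hZ
    have h2 := mdiffAt_pairing hg hZ hX'
    simp only [koszul, dirDeriv, e1, e2, mvfderiv_mul hf h1, mvfderiv_mul hf h2,
      VectorField.mlieBracket_smul_right hf hZ, VectorField.mlieBracket_smul_left hf hZ]
    simp [hg.symm p (Z p)]
    ring
  add := by
    intro Z Z' hZ hZ'
    have hX' := (hX p).mdifferentiableAt (by simp)
    have hY' := (hY p).mdifferentiableAt (by simp)
    have e1 : (fun q => g q (Y q) ((Z + Z') q)) =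
        (fun q => g q (Y q) (Z q)) + fun q => g q (Y q) (Z' q) := by
      ext q; simp
    have e2 : (fun q => g q ((Z + Z') q) (X q)) =
        (fun q => g q (Z q) (X q)) + fun q => g q (Z' q) (X q) := by
      ext q; simp
    have h1 := mdiffAt_pairing hg hY' hZ
    have h2 := mdiffAt_pairing hg hZ hX'
    have h1' := mdiffAt_pairing hg hY' hZ'
    have h2' := mdiffAt_pairing hg hZ' hX'
    simp only [koszul, dirDeriv, e1, e2, mvfderiv_add h1 h1', mvfderiv_add h2 h2',
      VectorField.mlieBracket_add_right hZ hZ', VectorField.mlieBracket_add_left hZ hZ']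
    simp
    ring

open Classical in
/-- The lower covariant derivative `∇^♭_X Y`: the `1`-form `Z ↦ 𝒦(X, Y, Z)`. The case distinction
only makes the definition total; see `lowerCovDeriv_apply`. -/
def lowerCovDeriv (g : FormField I M) (X Y : ∀ p : M, TangentSpace I p) : CovectorField I M :=
  fun p => if h : TensorialAt I E (fun Z => koszul g X Y Z p) p then
    TensorialAt.mkHom (fun Z => koszul g X Y Z p) p h else 0

theorem lowerCovDeriv_apply {g : FormField I M} (hg : IsSingularMetric g)
    {X Y Z : ∀ p : M, TangentSpace I p} (hX : IsSmoothVectorField X)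
    (hY : IsSmoothVectorField Y) (hZ : IsSmoothVectorField Z) (p : M) :
    lowerCovDeriv g X Y p (Z p) = koszul g X Y Z p := by
  rw [lowerCovDeriv, dif_pos (koszul_tensorialAt hg hX hY p)]
  exact TensorialAt.mkHom_apply _ ((hZ p).mdifferentiableAt (by simp))

/-- The value at `p` of `(∇_X η)(Y) = X(η(Y)) - ⟪∇^♭_X Y, η⟫_•`. -/
def covDeriv (g : FormField I M) (X : ∀ p : M, TangentSpace I p) (η : CovectorField I M)
    (Y : ∀ p : M, TangentSpace I p) (p : M) : ℝ :=
  dirDeriv X (fun q => η q (Y q)) p - coInner g p (lowerCovDeriv g X Y p) (η p)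

/-- `∇_X η ∈ 𝒜^•(M)`. As `⟪·, ·⟫_•` jumps where the signature of `g` changes, `∇_X η` is a priori
a `1`-form on the (open and dense) set of points near which the signature is constant; it belongs
to `𝒜^•(M)` if it extends from there to an element of `𝒜^•(M)`. -/
def CovDerivIsAnnihilatorForm (g : FormField I M) (X : ∀ p : M, TangentSpace I p)
    (η : CovectorField I M) : Prop :=
  ∃ θ : CovectorField I M, IsAnnihilatorForm g θ ∧
    ∀ Y : ∀ p : M, TangentSpace I p, IsSmoothVectorField Y →
      ∀ p, ConstSignatureAt g p → θ p (Y p) = covDeriv g X η Y p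

/-- `(M, g)` is radical-stationary: `∇^♭_X Y ∈ 𝒜^•(M)` for all smooth vector fields. -/
def IsRadicalStationary (g : FormField I M) : Prop :=
  ∀ X Y : ∀ p : M, TangentSpace I p, IsSmoothVectorField X → IsSmoothVectorField Y →
    IsAnnihilatorForm g (lowerCovDeriv g X Y)

/-- `(M, g)` is a semi-regular semi-Riemannian manifold: `g` is a singular metric, and
`∇^♭_X Y ∈ 𝒜^•(M)` and `∇_Z (∇^♭_X Y) ∈ 𝒜^•(M)` for all smooth vector fields. -/
structure IsSemiRegular (g : FormField I M) : Prop where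
  isSingularMetric : IsSingularMetric g
  isRadicalStationary : IsRadicalStationary g
  covDeriv_mem : ∀ X Y Z : ∀ p : M, TangentSpace I p,
    IsSmoothVectorField X → IsSmoothVectorField Y → IsSmoothVectorField Z →
      CovDerivIsAnnihilatorForm g Z (lowerCovDeriv g X Y)

end CovDeriv

section Warped

/-- The pullback `φ^* g`. -/
def pullbackForm {E' : Type*} [NormedAddCommGroup E'] [NormedSpace ℝ E']
    {H' : Type*} [TopologicalSpace H'] {I' : ModelWithCorners ℝ E' H'}
    {M' : Type*} [TopologicalSpace M'] [ChartedSpace H' M']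
    (φ : M → M') (g : FormField I' M') : FormField I M :=
  fun p => ContinuousLinearMap.bilinearComp (E := E') (F := E') (E' := E) (F' := E)
    (g (φ p)) (mfderiv I I' φ p) (mfderiv I I' φ p)

theorem pullbackForm_apply {E' : Type*} [NormedAddCommGroup E'] [NormedSpace ℝ E']
    {H' : Type*} [TopologicalSpace H'] {I' : ModelWithCorners ℝ E' H'}
    {M' : Type*} [TopologicalSpace M'] [ChartedSpace H' M']
    (φ : M → M') (g : FormField I' M') (p : M) (x y : TangentSpace I p) :
    pullbackForm (I := I) φ g p x y = g (φ p) (mfderiv I I' φ p x) (mfderiv I I' φ p y) :=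
  rfl

/-- The multiply warped product metric `π_B^* g_B + ∑ j, (f_j ∘ π_B)² π_{F_j}^* g_{F_j}` on
`B × F_1 × ⋯ × F_l`. -/
def multiplyWarpedMetric {EB : Type*} [NormedAddCommGroup EB] [NormedSpace ℝ EB]
    {HB : Type*} [TopologicalSpace HB] {IB : ModelWithCorners ℝ EB HB}
    {B : Type*} [TopologicalSpace B] [ChartedSpace HB B]
    {l : ℕ} {EF : Fin l → Type*} [∀ j, NormedAddCommGroup (EF j)] [∀ j, NormedSpace ℝ (EF j)]
    {HF : Fin l → Type*} [∀ j, TopologicalSpace (HF j)]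
    {IF : ∀ j, ModelWithCorners ℝ (EF j) (HF j)}
    {F : Fin l → Type*} [∀ j, TopologicalSpace (F j)] [∀ j, ChartedSpace (HF j) (F j)]
    (gB : FormField IB B) (gF : ∀ j, FormField (IF j) (F j)) (f : Fin l → B → ℝ) :
    FormField (IB.prod (ModelWithCorners.pi IF)) (B × ∀ j, F j) :=
  fun p => pullbackForm Prod.fst gB p +
    ∑ j, (f j p.1) ^ 2 • pullbackForm (fun q : B × ∀ j, F j => q.2 j) (gF j) p

end Warped

end

end SingularGeometry

/-! Everything is done in coordinates. There `∇^♭_X Y` is `g(∂_X Y, ·) + Γ(X, Y, ·)` with `Γ` the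
Christoffel symbols of the first kind, so semi-regularity becomes two conditions on constant fields
(`ChartSemiRegular`): each covector `Γ(x, y, ·)` has the form `g(v, ·)`, and `∂_z Γ(x, y, w) - ⟪Γ(z,
w, ·), Γ(x, y, ·)⟫_•` extends smoothly, within the range of `g`, across the points where the
signature jumps.

For the warped metric, differentiating `f_j²` leaves a factor `f_j`, so the Christoffel covector is
a functional of the base component plus terms `f_j g_j(c_j, ·)`. The base is non-degenerate and
represents any functional; the other terms equal `f_j² g_j(f_j⁻¹ c_j, ·)`, and vanish where `f_j`
does (`exists_warpedForm_eq`). The representing vector need not be smooth, since membership in the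
range is a pointwise condition. In the second condition the fibre part of the inner product is a
priori singular like a quotient by `f_j`, but expanding it where `f_j ≠ 0` makes all denominators
cancel (`fiber_identity`). What remains is `warpedExtension`: polynomial in `f_j`, its derivatives
and smooth fibre data, hence smooth through the zeros of `f_j`, and again in the range of the
metric.

The extension must agree with the true covariant derivative wherever the signature of the product is
locally constant. The nullity of the product is the sum of the nullities of the `f_j² g_j`, each
upper semicontinuous, so each of them is locally constant there. This leaves three cases for every
`j`: `f_j` vanishes nearby, `g_j` vanishes nearby, or `f_j ≠ 0` and `g_j` has locally constant
signature (`ConstSignatureAt.of_multiplyWarpedMetric`). The first two are trivial and the third is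
`fiber_identity`.

The passage between charts and manifolds uses bump functions in one direction
(`IsSemiRegular.exists_chartSemiRegular`). In the other, local extensions are glued
(`isSemiRegular_of_chart`): they agree on the points of locally constant signature, which are dense
by semicontinuity of the indices of inertia, hence everywhere. -/

namespace SingularGeometry

set_option synthInstance.maxHeartbeats 200000

/-! ### Christoffel symbols of the first kind and semi-regularity in coordinates -/

section Christoffel

variable {E : Type*} [NormedAddCommGroup E] [NormedSpace ℝ E]

/-- The Christoffel symbols of the first kind of a field of bilinear forms on a vector space. -/
noncomputable def christoffel (G : E → E →L[ℝ] E →L[ℝ] ℝ) (u x y w : E) : ℝ :=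
  (1 / 2 : ℝ) * (fderiv ℝ G u x y w + fderiv ℝ G u y w x - fderiv ℝ G u w x y)

/-- Semi-regularity of a field `G` of symmetric bilinear forms on an open subset `U` of a vector
space, in terms of the Christoffel symbols; the covariant derivatives of the lower covariant
derivatives of constant vector fields are only compared with their smooth extensions on `S`. -/
structure ChartSemiRegular (G : E → E →L[ℝ] E →L[ℝ] ℝ) (U S : Set E) : Prop where
  smooth : ∀ u ∈ U, ContDiffAt ℝ ∞ G u
  symm : ∀ u ∈ U, ∀ x y, G u x y = G u y x
  christoffel_mem : ∀ u ∈ U, ∀ x y, ∃ v, ∀ w, christoffel G u x y w = G u v w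
  exists_extension : ∀ x y z, ∃ r : E → E → ℝ,
    (∀ u ∈ U, ∀ w, ContDiffAt ℝ ∞ (fun u' => r u' w) u) ∧
    (∀ u ∈ U, ∃ v, ∀ w, r u w = G u v w) ∧
    -- The number `G u a b` is `⟪·, ·⟫_•` of the two Christoffel covectors; by symmetry of `G` it
    -- does not depend on the representatives `a` and `b`.
    ∀ u ∈ U, u ∈ S → ∀ w a b, (∀ w', christoffel G u z w w' = G u a w') →
      (∀ w', christoffel G u x y w' = G u b w') →
      r u w = fderiv ℝ (fun u' => christoffel G u' x y w) u z - G u a b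

variable {G : E → E →L[ℝ] E →L[ℝ] ℝ} {u : E}

theorem christoffel_add_right (x y w w' : E) :
    christoffel G u x y (w + w') = christoffel G u x y w + christoffel G u x y w' := by
  simp only [christoffel, map_add, add_apply]; ring

theorem christoffel_smul_right (c : ℝ) (x y w : E) :
    christoffel G u x y (c • w) = c * christoffel G u x y w := by
  simp only [christoffel, map_smul, smul_apply, smul_eq_mul]; ring

theorem fderiv_apply_apply (hG : DifferentiableAt ℝ G u) (z x y : E) :
    fderiv ℝ (fun u' => G u' x y) u z = fderiv ℝ G u z x y := by
  have h : HasFDerivAt (fun u' => G u' x y) _ u :=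
    ((hG.hasFDerivAt.clm_apply (hasFDerivAt_const x u)).clm_apply (hasFDerivAt_const y u))
  rw [h.fderiv]
  simp

theorem fderiv_apply_symm (hG : DifferentiableAt ℝ G u)
    (hs : ∀ᶠ u' in 𝓝 u, ∀ x y, G u' x y = G u' y x) (z x y : E) :
    fderiv ℝ G u z x y = fderiv ℝ G u z y x := by
  rw [← fderiv_apply_apply hG, ← fderiv_apply_apply hG]
  congr 1
  apply Filter.EventuallyEq.fderiv_eq
  filter_upwards [hs] with u' h using h x y

/-- Compatibility of the Levi-Civita connection with the metric, in a form that needs no inverse of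
`G`. -/
theorem christoffel_add_christoffel (hG : DifferentiableAt ℝ G u)
    (hs : ∀ᶠ u' in 𝓝 u, ∀ x y, G u' x y = G u' y x) (z x y : E) :
    christoffel G u z x y + christoffel G u z y x = fderiv ℝ G u z x y := by
  have h1 := fderiv_apply_symm hG hs z x y
  have h2 := fderiv_apply_symm hG hs x z y
  have h3 := fderiv_apply_symm hG hs y z x
  simp only [christoffel]
  linarith

theorem contDiffAt_fderiv_apply {F : Type*} [NormedAddCommGroup F] [NormedSpace ℝ F]
    {f : E → F} (hf : ContDiffAt ℝ ∞ f u) : ContDiffAt ℝ ∞ (fderiv ℝ f) u :=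
  hf.fderiv_right (by simp)

/-- In finite dimension an operator is the tuple of its values on a basis, so its smoothness can be
tested on fixed vectors. -/
theorem contDiffAt_clm_of_apply {D F : Type*} [NormedAddCommGroup D] [NormedSpace ℝ D]
    [FiniteDimensional ℝ E] [NormedAddCommGroup F] [NormedSpace ℝ F] {f : D → E →L[ℝ] F} {u : D}
    (h : ∀ y, ContDiffAt ℝ ∞ (fun x => f x y) u) : ContDiffAt ℝ ∞ f u := by
  let e₁ := ContinuousLinearEquiv.ofFinrankEq
    (Module.finrank_fin_fun ℝ (n := Module.finrank ℝ E)).symm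
  let e₂ := (e₁.arrowCongr (1 : F ≃L[ℝ] F)).trans (ContinuousLinearEquiv.piRing _)
  rw [← Function.id_comp f, ← e₂.symm_comp_self]
  exact e₂.symm.contDiff.contDiffAt.comp u (contDiffAt_pi.mpr fun i => h _)

theorem contDiffAt_christoffel_comp {D : Type*} [NormedAddCommGroup D] [NormedSpace ℝ D]
    {b X Y W : D → E} {d : D} (hG : ContDiffAt ℝ ∞ G (b d)) (hb : ContDiffAt ℝ ∞ b d)
    (hX : ContDiffAt ℝ ∞ X d) (hY : ContDiffAt ℝ ∞ Y d) (hW : ContDiffAt ℝ ∞ W d) :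
    ContDiffAt ℝ ∞ (fun d' => christoffel G (b d') (X d') (Y d') (W d')) d := by
  have h := (contDiffAt_fderiv_apply hG).comp d hb
  unfold christoffel
  exact contDiffAt_const.mul (((((h.clm_apply hX).clm_apply hY).clm_apply hW).add
    (((h.clm_apply hY).clm_apply hW).clm_apply hX)).sub
    (((h.clm_apply hW).clm_apply hX).clm_apply hY))

theorem contDiffAt_christoffel (hG : ContDiffAt ℝ ∞ G u) {X Y W : E → E}
    (hX : ContDiffAt ℝ ∞ X u) (hY : ContDiffAt ℝ ∞ Y u) (hW : ContDiffAt ℝ ∞ W u) :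
    ContDiffAt ℝ ∞ (fun u' => christoffel G u' (X u') (Y u') (W u')) u :=
  contDiffAt_christoffel_comp (b := fun u => u) hG contDiffAt_id hX hY hW

end Christoffel

/-! ### Raising an index with a non-degenerate form -/

section Raising

variable {E F : Type*} [NormedAddCommGroup E] [NormedSpace ℝ E]
  [NormedAddCommGroup F] [NormedSpace ℝ F] [FiniteDimensional ℝ F]

theorem exists_eq_apply_of_nondegenerate {g : F →L[ℝ] F →L[ℝ] ℝ}
    (hg : ∀ x, (∀ y, g x y = 0) → x = 0) :
    ∃ e : F ≃L[ℝ] (F →L[ℝ] ℝ), (e : F →L[ℝ] F →L[ℝ] ℝ) = g := by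
  have hinj : Function.Injective g.toLinearMap := by
    rw [← LinearMap.ker_eq_bot, LinearMap.ker_eq_bot']
    intro x hx
    exact hg x fun y => by simpa using congrArg (fun l => l y) hx
  have hdim : Module.finrank ℝ F = Module.finrank ℝ (F →L[ℝ] ℝ) := by
    rw [← (LinearMap.toContinuousLinearMap (𝕜 := ℝ) (E := F) (F' := ℝ)).finrank_eq]
    exact (Subspace.dual_finrank_eq (K := ℝ) (V := F)).symm
  let e := LinearEquiv.ofInjectiveOfFinrankEq g.toLinearMap hinj hdim
  exact ⟨e.toContinuousLinearEquiv, by ext x y; rfl⟩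

/-- Raising the index of a smooth family of functionals with a smooth non-degenerate form. -/
theorem exists_raise {G : E → F →L[ℝ] F →L[ℝ] ℝ} {U : Set E}
    (hG : ∀ u ∈ U, ContDiffAt ℝ ∞ G u) (hnd : ∀ u ∈ U, ∀ x, (∀ y, G u x y = 0) → x = 0)
    {α : E → F → ℝ} (hα : ∀ u ∈ U, ∀ b, ContDiffAt ℝ ∞ (fun u' => α u' b) u)
    (hlin : ∀ u ∈ U, IsLinearMap ℝ (α u)) :
    ∃ β : E → F, ∀ u ∈ U, ContDiffAt ℝ ∞ β u ∧ ∀ b, G u (β u) b = α u b := by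
  let e := Module.finBasis ℝ F
  -- Rebuilding the functional from its values on a basis gives a family of operators that is
  -- visibly smooth. `inverse` is a total function, but on `U` it is the genuine inverse and smooth
  -- there.
  let α' : E → F →L[ℝ] ℝ := fun u => ∑ i, α u (e i) • (e.coord i).toContinuousLinearMap
  refine ⟨fun u => (G u).inverse (α' u), fun u hu => ?_⟩
  obtain ⟨eq, he⟩ := exists_eq_apply_of_nondegenerate (hnd u hu)
  constructor
  · have h1 : ContDiffAt ℝ ∞ α' u :=
      ContDiffAt.sum fun i _ => (hα u hu (e i)).smul contDiffAt_const
    have h2 : ContDiffAt ℝ ∞ (fun u => (G u).inverse) u := by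
      have := contDiffAt_map_inverse (n := ∞) eq
      rw [he] at this
      exact this.comp u (hG u hu)
    exact h2.clm_apply h1
  · intro b
    have h3 : G u ((G u).inverse (α' u)) = α' u := by
      rw [← he, ContinuousLinearMap.inverse_equiv]
      simp
    rw [h3]
    have h4 : α u b = (hlin u hu).mk' _ (∑ i, e.repr b i • e i) := by
      rw [e.sum_repr]; rfl
    rw [h4, map_sum]
    simp only [α', sum_apply]
    refine Finset.sum_congr rfl fun i _ => ?_
    simp [mul_comm]

end Raising

/-! ### Warped products of forms on vector spaces and the derivatives of their Christoffel symbols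
-/

section WarpedForm

variable {EB : Type*} [NormedAddCommGroup EB] [NormedSpace ℝ EB]
  {l : ℕ} {EF : Fin l → Type*} [∀ j, NormedAddCommGroup (EF j)] [∀ j, NormedSpace ℝ (EF j)]

/-- The projection of `EB × ∏ EF j` onto a fibre. -/
def fiberProj (EB : Type*) [NormedAddCommGroup EB] [NormedSpace ℝ EB]
    {l : ℕ} (EF : Fin l → Type*) [∀ j, NormedAddCommGroup (EF j)] [∀ j, NormedSpace ℝ (EF j)]
    (j : Fin l) : (EB × ∀ j, EF j) →L[ℝ] EF j :=
  (ContinuousLinearMap.proj j).comp (ContinuousLinearMap.snd ℝ EB (∀ j, EF j))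

@[simp] theorem fiberProj_apply (j : Fin l) (v : EB × ∀ j, EF j) :
    fiberProj EB EF j v = v.2 j := rfl

/-- The multiply warped product of fields of bilinear forms on vector spaces. -/
noncomputable def warpedForm (GB : EB → EB →L[ℝ] EB →L[ℝ] ℝ)
    (GF : ∀ j, EF j → EF j →L[ℝ] EF j →L[ℝ] ℝ) (f : Fin l → EB → ℝ) (u : EB × ∀ j, EF j) :
    (EB × ∀ j, EF j) →L[ℝ] (EB × ∀ j, EF j) →L[ℝ] ℝ :=
  (GB u.1).bilinearComp (ContinuousLinearMap.fst ℝ EB _) (ContinuousLinearMap.fst ℝ EB _) +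
    ∑ j, (f j u.1) ^ 2 • (GF j (u.2 j)).bilinearComp (fiberProj EB EF j) (fiberProj EB EF j)

variable {GB : EB → EB →L[ℝ] EB →L[ℝ] ℝ} {GF : ∀ j, EF j → EF j →L[ℝ] EF j →L[ℝ] ℝ}
  {f : Fin l → EB → ℝ}

theorem warpedForm_apply (u v w : EB × ∀ j, EF j) :
    warpedForm GB GF f u v w =
      GB u.1 v.1 w.1 + ∑ j, (f j u.1) ^ 2 * GF j (u.2 j) (v.2 j) (w.2 j) := by
  simp [warpedForm]

theorem contDiffAt_warpedForm [FiniteDimensional ℝ EB] [∀ j, FiniteDimensional ℝ (EF j)]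
    {u : EB × ∀ j, EF j} (hB : ContDiffAt ℝ ∞ GB u.1)
    (hF : ∀ j, ContDiffAt ℝ ∞ (GF j) (u.2 j)) (hf : ∀ j, ContDiffAt ℝ ∞ (f j) u.1) :
    ContDiffAt ℝ ∞ (warpedForm GB GF f) u := by
  refine contDiffAt_clm_of_apply fun v => contDiffAt_clm_of_apply fun w => ?_
  simp only [warpedForm_apply]
  have h1 : ContDiffAt ℝ ∞ (fun u : EB × ∀ j, EF j => GB u.1) u := hB.comp u contDiffAt_fst
  have h2 : ∀ j, ContDiffAt ℝ ∞ (fun u : EB × ∀ j, EF j => f j u.1) u :=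
    fun j => (hf j).comp u contDiffAt_fst
  have h3 : ∀ j, ContDiffAt ℝ ∞ (fun u : EB × ∀ j, EF j => GF j (u.2 j)) u :=
    fun j => (hF j).comp u (fiberProj EB EF j).contDiff.contDiffAt
  refine ((h1.clm_apply contDiffAt_const).clm_apply contDiffAt_const).add
    (ContDiffAt.sum fun j _ => ?_)
  exact ((h2 j).pow 2).mul (((h3 j).clm_apply contDiffAt_const).clm_apply contDiffAt_const)

theorem HasFDerivAt.comp_base {F : Type*} [NormedAddCommGroup F] [NormedSpace ℝ F]
    {h : EB → F} {u : EB × ∀ j, EF j} (hh : DifferentiableAt ℝ h u.1) :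
    HasFDerivAt (fun u' : EB × ∀ j, EF j => h u'.1)
      ((fderiv ℝ h u.1).comp (ContinuousLinearMap.fst ℝ EB _)) u :=
  hh.hasFDerivAt.comp u hasFDerivAt_fst

theorem HasFDerivAt.comp_fiber {F : Type*} [NormedAddCommGroup F] [NormedSpace ℝ F]
    {j : Fin l} {h : EF j → F} {u : EB × ∀ j, EF j} (hh : DifferentiableAt ℝ h (u.2 j)) :
    HasFDerivAt (fun u' : EB × ∀ j, EF j => h (u'.2 j))
      ((fderiv ℝ h (u.2 j)).comp (fiberProj EB EF j)) u :=
  hh.hasFDerivAt.comp u (fiberProj EB EF j).hasFDerivAt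

theorem fderiv_warpedForm {u : EB × ∀ j, EF j} (hW : DifferentiableAt ℝ (warpedForm GB GF f) u)
    (hB : DifferentiableAt ℝ GB u.1)
    (hF : ∀ j, DifferentiableAt ℝ (GF j) (u.2 j)) (hf : ∀ j, DifferentiableAt ℝ (f j) u.1)
    (z x y : EB × ∀ j, EF j) :
    fderiv ℝ (warpedForm GB GF f) u z x y = fderiv ℝ GB u.1 z.1 x.1 y.1 +
      ∑ j, (2 * f j u.1 * fderiv ℝ (f j) u.1 z.1 * GF j (u.2 j) (x.2 j) (y.2 j) +
        f j u.1 ^ 2 * fderiv ℝ (GF j) (u.2 j) (z.2 j) (x.2 j) (y.2 j)) := by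
  rw [← fderiv_apply_apply hW]
  simp only [warpedForm_apply]
  have h1 : HasFDerivAt (fun u' : EB × ∀ j, EF j => GB u'.1 x.1 y.1) _ u :=
    ((HasFDerivAt.comp_base hB).clm_apply (hasFDerivAt_const x.1 u)).clm_apply
      (hasFDerivAt_const y.1 u)
  have h2 : ∀ j, HasFDerivAt (fun u' : EB × ∀ j, EF j =>
      f j u'.1 ^ 2 * GF j (u'.2 j) (x.2 j) (y.2 j)) _ u := fun j =>
    ((HasFDerivAt.comp_base (hf j)).pow 2).mul
      (((HasFDerivAt.comp_fiber (hF j)).clm_apply (hasFDerivAt_const (x.2 j) u)).clm_apply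
      (hasFDerivAt_const (y.2 j) u))
  have h3 : HasFDerivAt (fun u' : EB × ∀ j, EF j => GB u'.1 x.1 y.1 +
      ∑ j, f j u'.1 ^ 2 * GF j (u'.2 j) (x.2 j) (y.2 j)) _ u :=
    h1.add (HasFDerivAt.fun_sum fun j _ => h2 j)
  rw [h3.fderiv]
  simp only [add_apply, sum_apply]
  congr 1
  · simp
  · refine Finset.sum_congr rfl fun j _ => ?_
    simp
    ring

/-- The derivative `2 f df` of `f²` cancels the factor `1/2` and keeps one factor `f`. Hence every
fibre term is divisible by `f j`, on which the whole argument rests. -/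
theorem christoffel_warpedForm {u : EB × ∀ j, EF j}
    (hW : DifferentiableAt ℝ (warpedForm GB GF f) u) (hB : DifferentiableAt ℝ GB u.1)
    (hF : ∀ j, DifferentiableAt ℝ (GF j) (u.2 j)) (hf : ∀ j, DifferentiableAt ℝ (f j) u.1)
    (x y w : EB × ∀ j, EF j) :
    christoffel (warpedForm GB GF f) u x y w = christoffel GB u.1 x.1 y.1 w.1 +
      ∑ j, (f j u.1 * (fderiv ℝ (f j) u.1 x.1 * GF j (u.2 j) (y.2 j) (w.2 j) +
          fderiv ℝ (f j) u.1 y.1 * GF j (u.2 j) (w.2 j) (x.2 j) -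
          fderiv ℝ (f j) u.1 w.1 * GF j (u.2 j) (x.2 j) (y.2 j)) +
        f j u.1 ^ 2 * christoffel (GF j) (u.2 j) (x.2 j) (y.2 j) (w.2 j)) := by
  simp only [christoffel, fderiv_warpedForm hW hB hF hf]
  -- The equivalence cancels the base contribution and leaves an identity between sums over the
  -- fibres.
  rw [show ∀ a b c A B C D : ℝ, (1 / 2 : ℝ) * (a + A + (b + B) - (c + C)) =
      (1 / 2) * (a + b - c) + D ↔ (1 / 2 : ℝ) * (A + B - C) = D from
    fun a b c A B C D => by constructor <;> intro h <;> linarith]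
  rw [← Finset.sum_add_distrib, ← Finset.sum_sub_distrib, Finset.mul_sum]
  refine Finset.sum_congr rfl fun j _ => ?_
  ring

end WarpedForm

section ProductDomain

variable {EB : Type*} {l : ℕ} {EF : Fin l → Type*} {UB : Set EB} {UF : ∀ j, Set (EF j)}

/-- The product of open sets in the base and in the fibres. -/
def productDomain (UB : Set EB) (UF : ∀ j, Set (EF j)) : Set (EB × ∀ j, EF j) :=
  {u | u.1 ∈ UB ∧ ∀ j, u.2 j ∈ UF j}

theorem isOpen_productDomain [TopologicalSpace EB] [∀ j, TopologicalSpace (EF j)]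
    (hUB : IsOpen UB) (hUF : ∀ j, IsOpen (UF j)) :
    IsOpen (productDomain UB UF) := by
  have : productDomain UB UF = UB ×ˢ Set.univ.pi UF := by
    ext u; simp [productDomain]
  rw [this]
  exact hUB.prod (isOpen_set_pi Set.finite_univ fun j _ => hUF j)

end ProductDomain

section WarpedSemiRegular

variable {EB : Type*} [NormedAddCommGroup EB] [NormedSpace ℝ EB]
  {l : ℕ} {EF : Fin l → Type*} [∀ j, NormedAddCommGroup (EF j)] [∀ j, NormedSpace ℝ (EF j)]
  {GB : EB → EB →L[ℝ] EB →L[ℝ] ℝ} {GF : ∀ j, EF j → EF j →L[ℝ] EF j →L[ℝ] ℝ}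
  {f : Fin l → EB → ℝ} {UB : Set EB} {UF : ∀ j, Set (EF j)}

variable [FiniteDimensional ℝ EB] [∀ j, FiniteDimensional ℝ (EF j)]

theorem fderiv_christoffel_warpedForm (hUB : IsOpen UB) (hUF : ∀ j, IsOpen (UF j))
    (hB : ∀ b ∈ UB, ContDiffAt ℝ ∞ GB b) (hF : ∀ j, ∀ c ∈ UF j, ContDiffAt ℝ ∞ (GF j) c)
    (hf : ∀ j, ∀ b ∈ UB, ContDiffAt ℝ ∞ (f j) b) {u : EB × ∀ j, EF j}
    (hu : u ∈ productDomain UB UF) (x y w z : EB × ∀ j, EF j) :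
    fderiv ℝ (fun u' => christoffel (warpedForm GB GF f) u' x y w) u z =
      fderiv ℝ (fun b => christoffel GB b x.1 y.1 w.1) u.1 z.1 +
      ∑ j, (fderiv ℝ (f j) u.1 z.1 * (fderiv ℝ (f j) u.1 x.1 * GF j (u.2 j) (y.2 j) (w.2 j) +
          fderiv ℝ (f j) u.1 y.1 * GF j (u.2 j) (w.2 j) (x.2 j) -
          fderiv ℝ (f j) u.1 w.1 * GF j (u.2 j) (x.2 j) (y.2 j)) +
        f j u.1 * (fderiv ℝ (fun b => fderiv ℝ (f j) b x.1) u.1 z.1 *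
            GF j (u.2 j) (y.2 j) (w.2 j) +
          fderiv ℝ (f j) u.1 x.1 * fderiv ℝ (GF j) (u.2 j) (z.2 j) (y.2 j) (w.2 j) +
          (fderiv ℝ (fun b => fderiv ℝ (f j) b y.1) u.1 z.1 * GF j (u.2 j) (w.2 j) (x.2 j) +
          fderiv ℝ (f j) u.1 y.1 * fderiv ℝ (GF j) (u.2 j) (z.2 j) (w.2 j) (x.2 j)) -
          (fderiv ℝ (fun b => fderiv ℝ (f j) b w.1) u.1 z.1 * GF j (u.2 j) (x.2 j) (y.2 j) +
          fderiv ℝ (f j) u.1 w.1 * fderiv ℝ (GF j) (u.2 j) (z.2 j) (x.2 j) (y.2 j))) +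
        2 * f j u.1 * fderiv ℝ (f j) u.1 z.1 *
          christoffel (GF j) (u.2 j) (x.2 j) (y.2 j) (w.2 j) +
        f j u.1 ^ 2 *
          fderiv ℝ (fun c => christoffel (GF j) c (x.2 j) (y.2 j) (w.2 j)) (u.2 j) (z.2 j)) := by
  have hev : (fun u' => christoffel (warpedForm GB GF f) u' x y w) =ᶠ[𝓝 u] fun u' =>
      christoffel GB u'.1 x.1 y.1 w.1 +
      ∑ j, (f j u'.1 * (fderiv ℝ (f j) u'.1 x.1 * GF j (u'.2 j) (y.2 j) (w.2 j) +
          fderiv ℝ (f j) u'.1 y.1 * GF j (u'.2 j) (w.2 j) (x.2 j) -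
          fderiv ℝ (f j) u'.1 w.1 * GF j (u'.2 j) (x.2 j) (y.2 j)) +
        f j u'.1 ^ 2 * christoffel (GF j) (u'.2 j) (x.2 j) (y.2 j) (w.2 j)) := by
    filter_upwards [(isOpen_productDomain hUB hUF).mem_nhds hu] with u' hu'
    exact christoffel_warpedForm
      ((contDiffAt_warpedForm (hB _ hu'.1) (fun j => hF j _ (hu'.2 j))
        (fun j => hf j _ hu'.1)).differentiableAt (by simp))
      ((hB _ hu'.1).differentiableAt (by simp))
      (fun j => (hF j _ (hu'.2 j)).differentiableAt (by simp))
      (fun j => (hf j _ hu'.1).differentiableAt (by simp)) x y w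
  rw [hev.fderiv_eq]
  have hf1 : ∀ j, HasFDerivAt (fun u' : EB × ∀ j, EF j => f j u'.1) _ u := fun j =>
    HasFDerivAt.comp_base ((hf j _ hu.1).differentiableAt (by simp))
  have hf2 : ∀ j (a : EB), HasFDerivAt (fun u' : EB × ∀ j, EF j => fderiv ℝ (f j) u'.1 a) _ u :=
    fun j a => HasFDerivAt.comp_base (h := fun b => fderiv ℝ (f j) b a)
      (((contDiffAt_fderiv_apply (hf j _ hu.1)).clm_apply contDiffAt_const).differentiableAt
        (by simp))
  have hG : ∀ j (a c : EF j), HasFDerivAt (fun u' : EB × ∀ j, EF j => GF j (u'.2 j) a c) _ u :=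
    fun j a c => HasFDerivAt.comp_fiber (h := fun b => GF j b a c)
      ((((hF j _ (hu.2 j)).clm_apply contDiffAt_const).clm_apply
        contDiffAt_const).differentiableAt (by simp))
  have hC : ∀ j, HasFDerivAt (fun u' : EB × ∀ j, EF j =>
      christoffel (GF j) (u'.2 j) (x.2 j) (y.2 j) (w.2 j)) _ u := fun j =>
    HasFDerivAt.comp_fiber (h := fun c => christoffel (GF j) c (x.2 j) (y.2 j) (w.2 j))
      ((contDiffAt_christoffel (hF j _ (hu.2 j)) contDiffAt_const contDiffAt_const
        contDiffAt_const).differentiableAt (by simp))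
  have h1 : HasFDerivAt (fun u' : EB × ∀ j, EF j => christoffel GB u'.1 x.1 y.1 w.1) _ u :=
    HasFDerivAt.comp_base (h := fun b => christoffel GB b x.1 y.1 w.1)
      ((contDiffAt_christoffel (hB _ hu.1) contDiffAt_const contDiffAt_const
        contDiffAt_const).differentiableAt (by simp))
  have h2 : ∀ j, HasFDerivAt (fun u' : EB × ∀ j, EF j =>
      f j u'.1 * (fderiv ℝ (f j) u'.1 x.1 * GF j (u'.2 j) (y.2 j) (w.2 j) +
          fderiv ℝ (f j) u'.1 y.1 * GF j (u'.2 j) (w.2 j) (x.2 j) -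
          fderiv ℝ (f j) u'.1 w.1 * GF j (u'.2 j) (x.2 j) (y.2 j)) +
        f j u'.1 ^ 2 * christoffel (GF j) (u'.2 j) (x.2 j) (y.2 j) (w.2 j)) _ u := fun j =>
    ((hf1 j).mul ((((hf2 j _).mul (hG j _ _)).add ((hf2 j _).mul (hG j _ _))).sub
      ((hf2 j _).mul (hG j _ _)))).add (((hf1 j).pow 2).mul (hC j))
  have h3 := h1.add (HasFDerivAt.fun_sum (u := Finset.univ) fun j _ => h2 j)
  refine (congrArg (fun L => L z) h3.fderiv).trans ?_
  simp only [add_apply, sum_apply]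
  congr 1
  refine Finset.sum_congr rfl fun j _ => ?_
  have e : ∀ a c : EF j, fderiv ℝ (fun c' => GF j c' a c) (u.2 j) (z.2 j) =
      fderiv ℝ (GF j) (u.2 j) (z.2 j) a c :=
    fun a c => fderiv_apply_apply ((hF j _ (hu.2 j)).differentiableAt (by simp)) _ _ _
  simp only [← e]
  simp
  ring

end WarpedSemiRegular

/-! ### Linearity of the Christoffel symbols in each slot -/

section ChristoffelLinear

variable {E : Type*} [NormedAddCommGroup E] [NormedSpace ℝ E]
  {G : E → E →L[ℝ] E →L[ℝ] ℝ} {u : E}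

theorem christoffel_add_middle (x y y' w : E) :
    christoffel G u x (y + y') w = christoffel G u x y w + christoffel G u x y' w := by
  simp only [christoffel, map_add, add_apply]; ring

theorem christoffel_smul_middle (c : ℝ) (x y w : E) :
    christoffel G u x (c • y) w = c * christoffel G u x y w := by
  simp only [christoffel, map_smul, smul_apply, smul_eq_mul]; ring

theorem christoffel_add_left (x x' y w : E) :
    christoffel G u (x + x') y w = christoffel G u x y w + christoffel G u x' y w := by
  simp only [christoffel, map_add, add_apply]; ring

theorem christoffel_smul_left (c : ℝ) (x y w : E) :
    christoffel G u (c • x) y w = c * christoffel G u x y w := by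
  simp only [christoffel, map_smul, smul_apply, smul_eq_mul]; ring

theorem isLinearMap_christoffel (x y : E) : IsLinearMap ℝ (christoffel G u x y) :=
  ⟨christoffel_add_right x y, fun c => christoffel_smul_right c x y⟩

theorem isLinearMap_fderiv_christoffel (hG : ContDiffAt ℝ ∞ G u) (x y z : E) :
    IsLinearMap ℝ (fun w => fderiv ℝ (fun u' => christoffel G u' x y w) u z) := by
  have hd : ∀ w, DifferentiableAt ℝ (fun u' => christoffel G u' x y w) u := fun w =>
    (contDiffAt_christoffel hG contDiffAt_const contDiffAt_const
      contDiffAt_const).differentiableAt (by simp)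
  constructor
  · intro w w'
    simp only [christoffel_add_right]
    rw [fderiv_fun_add (hd w) (hd w')]
    rfl
  · intro c w
    simp only [christoffel_smul_right]
    rw [fderiv_const_mul (hd w)]
    rfl

theorem fderiv_fderiv_apply {f : E → ℝ} (hf : ContDiffAt ℝ ∞ f u) (x z : E) :
    fderiv ℝ (fun b => fderiv ℝ f b x) u z = fderiv ℝ (fderiv ℝ f) u z x := by
  have h : HasFDerivAt (fun b => fderiv ℝ f b x) _ u :=
    ((contDiffAt_fderiv_apply hf).differentiableAt (by simp)).hasFDerivAt.clm_apply
      (hasFDerivAt_const x u)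
  rw [h.fderiv]
  simp

end ChristoffelLinear

/-! ### The range of a warped form, and the algebra of a single fibre -/

section WarpedSemiRegular

variable {EB : Type*} [NormedAddCommGroup EB] [NormedSpace ℝ EB]
  {l : ℕ} {EF : Fin l → Type*} [∀ j, NormedAddCommGroup (EF j)] [∀ j, NormedSpace ℝ (EF j)]
  {GB : EB → EB →L[ℝ] EB →L[ℝ] ℝ} {GF : ∀ j, EF j → EF j →L[ℝ] EF j →L[ℝ] ℝ}
  {f : Fin l → EB → ℝ} {UB : Set EB} {UF : ∀ j, Set (EF j)}

theorem warpedForm_apply_base (u v : EB × ∀ j, EF j) (b : EB) :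
    warpedForm GB GF f u v (b, 0) = GB u.1 v.1 b := by
  simp [warpedForm_apply]

theorem warpedForm_apply_fiber (u v : EB × ∀ j, EF j) (j : Fin l) (c : EF j) :
    warpedForm GB GF f u v (0, Pi.single j c) = f j u.1 ^ 2 * GF j (u.2 j) (v.2 j) c := by
  rw [warpedForm_apply, Finset.sum_eq_single j]
  · simp
  · intro i _ hi
    simp [Pi.single_eq_of_ne hi]
  · simp

/-- This is the membership criterion for the range of the warped form: anything linear on the base
is allowed, while a fibre term needs just one factor `f j`, although the metric carries two. -/
theorem exists_warpedForm_eq [FiniteDimensional ℝ EB] {u : EB × ∀ j, EF j}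
    (hnd : ∀ x, (∀ y, GB u.1 x y = 0) → x = 0) {lam : EB → ℝ} (hlam : IsLinearMap ℝ lam)
    (c : ∀ j, EF j) : ∃ v, ∀ w, lam w.1 + ∑ j, f j u.1 * GF j (u.2 j) (c j) (w.2 j) =
      warpedForm GB GF f u v w := by
  obtain ⟨e, he⟩ := exists_eq_apply_of_nondegenerate hnd
  refine ⟨(e.symm (LinearMap.toContinuousLinearMap (hlam.mk' _)),
    -- At a zero of `f j` the convention `0⁻¹ = 0` gives the vector `0`; any vector would do, since
    -- both sides vanish there.
    fun j => (f j u.1)⁻¹ • c j), fun w => ?_⟩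
  rw [warpedForm_apply, ← he]
  congr 1
  · simp
  · refine Finset.sum_congr rfl fun j _ => ?_
    rcases eq_or_ne (f j u.1) 0 with h | h
    · simp [h]
    · simp only [map_smul, smul_apply, smul_eq_mul]
      field_simp

theorem christoffel_warpedForm_base {u : EB × ∀ j, EF j}
    (hW : DifferentiableAt ℝ (warpedForm GB GF f) u) (hB : DifferentiableAt ℝ GB u.1)
    (hF : ∀ j, DifferentiableAt ℝ (GF j) (u.2 j)) (hf : ∀ j, DifferentiableAt ℝ (f j) u.1)
    (x y : EB × ∀ j, EF j) (b : EB) :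
    christoffel (warpedForm GB GF f) u x y (b, 0) = christoffel GB u.1 x.1 y.1 b -
      ∑ j, f j u.1 * fderiv ℝ (f j) u.1 b * GF j (u.2 j) (x.2 j) (y.2 j) := by
  rw [christoffel_warpedForm hW hB hF hf, sub_eq_add_neg, ← Finset.sum_neg_distrib]
  congr 1
  refine Finset.sum_congr rfl fun j _ => ?_
  have h : christoffel (GF j) (u.2 j) (x.2 j) (y.2 j) 0 = 0 :=
    (isLinearMap_christoffel _ _).map_zero
  simp [h, mul_assoc]

theorem christoffel_warpedForm_fiber {u : EB × ∀ j, EF j}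
    (hW : DifferentiableAt ℝ (warpedForm GB GF f) u) (hB : DifferentiableAt ℝ GB u.1)
    (hF : ∀ j, DifferentiableAt ℝ (GF j) (u.2 j)) (hf : ∀ j, DifferentiableAt ℝ (f j) u.1)
    (x y : EB × ∀ j, EF j) (j : Fin l) (c : EF j) :
    christoffel (warpedForm GB GF f) u x y (0, Pi.single j c) =
      f j u.1 * (fderiv ℝ (f j) u.1 x.1 * GF j (u.2 j) (y.2 j) c +
          fderiv ℝ (f j) u.1 y.1 * GF j (u.2 j) c (x.2 j)) +
        f j u.1 ^ 2 * christoffel (GF j) (u.2 j) (x.2 j) (y.2 j) c := by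
  rw [christoffel_warpedForm hW hB hF hf, Finset.sum_eq_single j]
  · have h : christoffel GB u.1 x.1 y.1 0 = 0 := (isLinearMap_christoffel _ _).map_zero
    simp [h]
  · intro i _ hi
    have h : christoffel (GF i) (u.2 i) (x.2 i) (y.2 i) 0 = 0 :=
      (isLinearMap_christoffel _ _).map_zero
    simp [Pi.single_eq_of_ne hi, h]
  · simp

/-- The contribution of one fibre to the covariant derivative of the Christoffel symbols of a
multiply warped product. -/
theorem fiber_identity {F : Type*} [AddCommGroup F] [Module ℝ F] {G : F → F → ℝ}
    (hadd : ∀ a b c, G (a + b) c = G a c + G b c) (hsmul : ∀ (t : ℝ) a c, G (t • a) c = t * G a c)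
    (hsymm : ∀ a b, G a b = G b a) {Γ Γ' : F → ℝ}
    (hΓ' : IsLinearMap ℝ Γ')
    {φ dx dy dz dw R D : ℝ} {x y z w a b : F} (hφ : φ ≠ 0)
    (ha : ∀ c, φ ^ 2 * G a c = φ * (dz * G w c + dw * G c z) + φ ^ 2 * Γ' c)
    (hb : ∀ c, φ ^ 2 * G b c = φ * (dx * G y c + dy * G c x) + φ ^ 2 * Γ c)
    (hR : ∀ a' b', (∀ c, Γ' c = G a' c) → (∀ c, Γ c = G b' c) → R = D - G a' b') :
    φ ^ 2 * G a b = dz * dx * G w y + dz * dy * G w x + dw * dx * G z y + dw * dy * G z x +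
      φ * (dz * Γ w + dw * Γ z) + φ * (dx * Γ' y + dy * Γ' x) + φ ^ 2 * (D - R) := by
  -- Since `φ ≠ 0`, the fibre component `a` of the raised symbol of the product can be corrected to
  -- a vector representing the symbol `Γ'` of the fibre itself; likewise `b` for `Γ`. The fibre
  -- hypothesis `hR` then applies to the corrected vectors.
  have ha' : ∀ c, Γ' c = G (a + (-(dz / φ)) • w + (-(dw / φ)) • z) c := by
    intro c
    rw [hadd, hadd, hsmul, hsmul, hsymm z c]
    have := ha c
    field_simp
    exact mul_left_cancel₀ hφ (by linarith)
  have hb' : ∀ c, Γ c = G (b + (-(dx / φ)) • y + (-(dy / φ)) • x) c := by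
    intro c
    rw [hadd, hadd, hsmul, hsmul, hsymm x c]
    have := hb c
    field_simp
    exact mul_left_cancel₀ hφ (by linarith)
  have h := hR _ _ ha' hb'
  rw [h, ← ha', hΓ'.map_add, hΓ'.map_add, hΓ'.map_smul, hΓ'.map_smul]
  have h1 := ha b
  have h2 := hb w
  have h3 := hb z
  simp only [smul_eq_mul]
  rw [hsymm b w] at h2
  rw [hsymm b z] at h3
  rw [hsymm b z] at h1
  rw [hsymm y w] at h2
  rw [hsymm y z] at h3
  field_simp
  -- Dividing `hb` by one power of `φ` is what leaves a final formula without denominators.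
  have e2 : φ * G w b = dx * G w y + dy * G w x + φ * Γ w :=
    mul_left_cancel₀ hφ (by linarith)
  have e3 : φ * G z b = dx * G z y + dy * G z x + φ * Γ z :=
    mul_left_cancel₀ hφ (by linarith)
  have e1 : φ ^ 2 * G a b = dz * (φ * G w b) + dw * (φ * G z b) + φ ^ 2 * Γ' b := by linarith
  rw [e2, e3] at e1
  linarith

end WarpedSemiRegular

/-! ### Semi-regularity of a warped product in coordinates -/

section WarpedSemiRegular

variable {EB : Type*} [NormedAddCommGroup EB] [NormedSpace ℝ EB]
  {l : ℕ} {EF : Fin l → Type*} [∀ j, NormedAddCommGroup (EF j)] [∀ j, NormedSpace ℝ (EF j)]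
  {GB : EB → EB →L[ℝ] EB →L[ℝ] ℝ} {GF : ∀ j, EF j → EF j →L[ℝ] EF j →L[ℝ] ℝ}
  {f : Fin l → EB → ℝ} {UB : Set EB} {UF SF : ∀ j, Set (EF j)} {S : Set (EB × ∀ j, EF j)}

/-- In `christoffel_warpedForm` the terms with the derivative of `f j` along `w` depend only on the
base component of `w`, so the non-degenerate base absorbs them; all others have the shape `f j * GF
j (c j) (w j)`. -/
theorem exists_christoffel_warpedForm_eq [FiniteDimensional ℝ EB]
    [∀ j, FiniteDimensional ℝ (EF j)]
    (hB : ∀ b ∈ UB, ContDiffAt ℝ ∞ GB b)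
    (hnd : ∀ b ∈ UB, ∀ x, (∀ y, GB b x y = 0) → x = 0)
    (hF : ∀ j, ChartSemiRegular (GF j) (UF j) (SF j))
    (hf : ∀ j, ∀ b ∈ UB, ContDiffAt ℝ ∞ (f j) b)
    {u : EB × ∀ j, EF j} (hu : u ∈ productDomain UB UF) (x y : EB × ∀ j, EF j) :
    ∃ v, ∀ w, christoffel (warpedForm GB GF f) u x y w = warpedForm GB GF f u v w := by
  have hWs : ContDiffAt ℝ ∞ (warpedForm GB GF f) u :=
    contDiffAt_warpedForm (hB _ hu.1) (fun j => (hF j).smooth _ (hu.2 j)) (fun j => hf j _ hu.1)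
  choose v hv using fun j => (hF j).christoffel_mem (u.2 j) (hu.2 j) (x.2 j) (y.2 j)
  let lam : EB → ℝ := fun b => christoffel GB u.1 x.1 y.1 b -
      ∑ j, f j u.1 * fderiv ℝ (f j) u.1 b * GF j (u.2 j) (x.2 j) (y.2 j)
  have hlam : IsLinearMap ℝ lam := by
    constructor
    · intro b b'
      simp only [lam, christoffel_add_right, map_add, mul_add, add_mul, Finset.sum_add_distrib]
      ring
    · intro c b
      simp only [lam, christoffel_smul_right, map_smul, smul_eq_mul, mul_sub, Finset.mul_sum]
      congr 1
      exact Finset.sum_congr rfl fun j _ => by ring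
  obtain ⟨V, hV⟩ := exists_warpedForm_eq (GF := GF) (f := f) (hnd _ hu.1) hlam
    (fun j => fderiv ℝ (f j) u.1 x.1 • y.2 j + fderiv ℝ (f j) u.1 y.1 • x.2 j + f j u.1 • v j)
  refine ⟨V, fun w => ?_⟩
  rw [← hV, christoffel_warpedForm (hWs.differentiableAt (by simp))
      ((hB _ hu.1).differentiableAt (by simp))
      (fun j => ((hF j).smooth _ (hu.2 j)).differentiableAt (by simp))
      (fun j => (hf j _ hu.1).differentiableAt (by simp))]
  simp only [lam, sub_add_eq_add_sub, add_sub_assoc, ← Finset.sum_sub_distrib]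
  congr 1
  refine Finset.sum_congr rfl fun j _ => ?_
  simp only [map_add, map_smul, add_apply, smul_apply, smul_eq_mul, ← hv]
  rw [(hF j).symm _ (hu.2 j) (w.2 j) (x.2 j)]
  ring

/-- The value at `(u, w)` of the smooth extension of the covariant derivative along `z` of the
Christoffel symbol of `x` and `y`; `β` is the base component of the raised Christoffel symbol, and
`r` collects the extensions on the fibres. -/
noncomputable def warpedExtension (GB : EB → EB →L[ℝ] EB →L[ℝ] ℝ)
    (GF : ∀ j, EF j → EF j →L[ℝ] EF j →L[ℝ] ℝ) (f : Fin l → EB → ℝ)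
    (β : (EB × ∀ j, EF j) → EB) (r : ∀ j, EF j → EF j → ℝ) (x y z u w : EB × ∀ j, EF j) : ℝ :=
  (fderiv ℝ (fun b => christoffel GB b x.1 y.1 w.1) u.1 z.1 -
    christoffel GB u.1 z.1 w.1 (β u) -
    ∑ j, (fderiv ℝ (f j) u.1 w.1 * (fderiv ℝ (f j) u.1 z.1 * GF j (u.2 j) (x.2 j) (y.2 j) +
          fderiv ℝ (f j) u.1 x.1 * GF j (u.2 j) (z.2 j) (y.2 j) +
          fderiv ℝ (f j) u.1 y.1 * GF j (u.2 j) (z.2 j) (x.2 j) +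
          f j u.1 * fderiv ℝ (GF j) (u.2 j) (z.2 j) (x.2 j) (y.2 j) +
          f j u.1 * christoffel (GF j) (u.2 j) (x.2 j) (y.2 j) (z.2 j)) +
        fderiv ℝ (fun b => fderiv ℝ (f j) b w.1) u.1 z.1 *
          (f j u.1 * GF j (u.2 j) (x.2 j) (y.2 j)))) +
  -- From here on `w` enters through its fibre components, always behind a factor `f j`, as
  -- `exists_warpedForm_eq` requires; the terms above involve only the base component of `w`.
  ∑ j, f j u.1 * (fderiv ℝ (fun b => fderiv ℝ (f j) b x.1) u.1 z.1 *
        GF j (u.2 j) (y.2 j) (w.2 j) +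
      fderiv ℝ (fun b => fderiv ℝ (f j) b y.1) u.1 z.1 * GF j (u.2 j) (x.2 j) (w.2 j) +
      fderiv ℝ (f j) u.1 x.1 * christoffel (GF j) (u.2 j) (z.2 j) (y.2 j) (w.2 j) +
      fderiv ℝ (f j) u.1 y.1 * christoffel (GF j) (u.2 j) (z.2 j) (x.2 j) (w.2 j) +
      fderiv ℝ (f j) u.1 z.1 * christoffel (GF j) (u.2 j) (x.2 j) (y.2 j) (w.2 j) +
      fderiv ℝ (f j) u.1 (β u) * GF j (u.2 j) (z.2 j) (w.2 j) +
      f j u.1 * r j (u.2 j) (w.2 j))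

/-- No division by `f j` occurs in the formula, so zeros of the warping functions are harmless. -/
theorem contDiffAt_warpedExtension {u : EB × ∀ j, EF j}
    (hB : ContDiffAt ℝ ∞ GB u.1) (hF : ∀ j, ContDiffAt ℝ ∞ (GF j) (u.2 j))
    (hf : ∀ j, ContDiffAt ℝ ∞ (f j) u.1) {β : (EB × ∀ j, EF j) → EB} (hβ : ContDiffAt ℝ ∞ β u)
    {r : ∀ j, EF j → EF j → ℝ} (hr : ∀ j w, ContDiffAt ℝ ∞ (fun c => r j c w) (u.2 j))
    (x y z w : EB × ∀ j, EF j) :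
    ContDiffAt ℝ ∞ (fun u' => warpedExtension GB GF f β r x y z u' w) u := by
  have base : ∀ {h : EB → ℝ}, ContDiffAt ℝ ∞ h u.1 →
      ContDiffAt ℝ ∞ (fun u' : EB × ∀ j, EF j => h u'.1) u := fun h => h.comp u contDiffAt_fst
  have fib : ∀ {j} {h : EF j → ℝ}, ContDiffAt ℝ ∞ h (u.2 j) →
      ContDiffAt ℝ ∞ (fun u' : EB × ∀ j, EF j => h (u'.2 j)) u :=
    fun {j} {h} hh => hh.comp u (fiberProj EB EF j).contDiff.contDiffAt
  have hdf : ∀ j (a : EB), ContDiffAt ℝ ∞ (fun b => fderiv ℝ (f j) b a) u.1 := fun j a =>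
    (contDiffAt_fderiv_apply (hf j)).clm_apply contDiffAt_const
  have hddf : ∀ j (a c : EB),
      ContDiffAt ℝ ∞ (fun b => fderiv ℝ (fun b => fderiv ℝ (f j) b a) b c) u.1 := fun j a c =>
    (contDiffAt_fderiv_apply (hdf j a)).clm_apply contDiffAt_const
  have hG : ∀ j (a c : EF j), ContDiffAt ℝ ∞ (fun b => GF j b a c) (u.2 j) := fun j a c =>
    ((hF j).clm_apply contDiffAt_const).clm_apply contDiffAt_const
  have hdG : ∀ j (a c d : EF j), ContDiffAt ℝ ∞ (fun b => fderiv ℝ (GF j) b a c d) (u.2 j) :=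
    fun j a c d => (((contDiffAt_fderiv_apply (hF j)).clm_apply contDiffAt_const).clm_apply
      contDiffAt_const).clm_apply contDiffAt_const
  have hC : ∀ j (a c d : EF j), ContDiffAt ℝ ∞ (fun b => christoffel (GF j) b a c d) (u.2 j) :=
    fun j a c d => contDiffAt_christoffel (hF j) contDiffAt_const contDiffAt_const contDiffAt_const
  have hβf : ∀ j, ContDiffAt ℝ ∞ (fun u' : EB × ∀ j, EF j => fderiv ℝ (f j) u'.1 (β u')) u :=
    fun j => ((contDiffAt_fderiv_apply (hf j)).comp u contDiffAt_fst).clm_apply hβ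
  have hβC : ContDiffAt ℝ ∞ (fun u' : EB × ∀ j, EF j => christoffel GB u'.1 z.1 w.1 (β u')) u :=
    contDiffAt_christoffel_comp hB contDiffAt_fst contDiffAt_const contDiffAt_const hβ
  have hDC : ContDiffAt ℝ ∞ (fun b => fderiv ℝ (fun b => christoffel GB b x.1 y.1 w.1) b z.1) u.1 :=
    (contDiffAt_fderiv_apply (contDiffAt_christoffel hB contDiffAt_const contDiffAt_const
      contDiffAt_const)).clm_apply contDiffAt_const
  unfold warpedExtension
  refine (((base hDC).sub hβC).sub (ContDiffAt.sum fun j _ => ?_)).add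
    (ContDiffAt.sum fun j _ => ?_)
  · exact ((base (hdf j _)).mul ((((((base (hdf j _)).mul (fib (hG j _ _))).add
      ((base (hdf j _)).mul (fib (hG j _ _)))).add ((base (hdf j _)).mul (fib (hG j _ _)))).add
      ((base (hf j)).mul (fib (hdG j _ _ _)))).add ((base (hf j)).mul (fib (hC j _ _ _))))).add
      ((base (hddf j _ _)).mul ((base (hf j)).mul (fib (hG j _ _))))
  · exact (base (hf j)).mul ((((((((base (hddf j _ _)).mul (fib (hG j _ _))).add
      ((base (hddf j _ _)).mul (fib (hG j _ _)))).add
      ((base (hdf j _)).mul (fib (hC j _ _ _)))).add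
      ((base (hdf j _)).mul (fib (hC j _ _ _)))).add
      ((base (hdf j _)).mul (fib (hC j _ _ _)))).add
      ((hβf j).mul (fib (hG j _ _)))).add ((base (hf j)).mul (fib (hr j _))))

/-- Fibre Christoffel symbols and the fibre extensions `r j` lie in the range of `GF j`, so the
fibre part is `f j` times an element of that range; the rest is linear in the base component of `w`.
-/
theorem exists_warpedExtension_eq [FiniteDimensional ℝ EB]
    (hB : ∀ b ∈ UB, ContDiffAt ℝ ∞ GB b)
    (hnd : ∀ b ∈ UB, ∀ x, (∀ y, GB b x y = 0) → x = 0)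
    (hF : ∀ j, ChartSemiRegular (GF j) (UF j) (SF j))
    (hf : ∀ j, ∀ b ∈ UB, ContDiffAt ℝ ∞ (f j) b) (β : (EB × ∀ j, EF j) → EB)
    {r : ∀ j, EF j → EF j → ℝ} (hr : ∀ j, ∀ c ∈ UF j, ∃ v, ∀ w, r j c w = GF j c v w)
    {u : EB × ∀ j, EF j} (hu : u ∈ productDomain UB UF) (x y z : EB × ∀ j, EF j) :
    ∃ v, ∀ w, warpedExtension GB GF f β r x y z u w = warpedForm GB GF f u v w := by
  choose v hv using fun j => (hF j).christoffel_mem (u.2 j) (hu.2 j)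
  choose R hR using fun j => hr j (u.2 j) (hu.2 j)
  let K : Fin l → ℝ := fun j => fderiv ℝ (f j) u.1 z.1 * GF j (u.2 j) (x.2 j) (y.2 j) +
          fderiv ℝ (f j) u.1 x.1 * GF j (u.2 j) (z.2 j) (y.2 j) +
          fderiv ℝ (f j) u.1 y.1 * GF j (u.2 j) (z.2 j) (x.2 j) +
          f j u.1 * fderiv ℝ (GF j) (u.2 j) (z.2 j) (x.2 j) (y.2 j) +
          f j u.1 * christoffel (GF j) (u.2 j) (x.2 j) (y.2 j) (z.2 j)
  let lam : EB → ℝ := fun b => fderiv ℝ (fun b' => christoffel GB b' x.1 y.1 b) u.1 z.1 -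
    christoffel GB u.1 z.1 b (β u) -
    ∑ j, (fderiv ℝ (f j) u.1 b * K j + fderiv ℝ (fun b' => fderiv ℝ (f j) b' b) u.1 z.1 *
          (f j u.1 * GF j (u.2 j) (x.2 j) (y.2 j)))
  have hlam : IsLinearMap ℝ lam := by
    have h1 := isLinearMap_fderiv_christoffel (hB _ hu.1) x.1 y.1 z.1
    have h2 : ∀ j b, fderiv ℝ (fun b' => fderiv ℝ (f j) b' b) u.1 z.1 =
        fderiv ℝ (fderiv ℝ (f j)) u.1 z.1 b := fun j b => fderiv_fderiv_apply (hf j _ hu.1) _ _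
    constructor
    · intro b b'
      have h3 := h1.map_add b b'
      simp only [lam, h3, h2, christoffel_add_middle, map_add, add_mul, Finset.sum_add_distrib]
      ring
    · intro c b
      have h3 := h1.map_smul c b
      simp only [smul_eq_mul] at h3
      simp only [lam, h3, h2, christoffel_smul_middle, map_smul, smul_eq_mul, mul_sub,
        Finset.mul_sum]
      congr 1
      exact Finset.sum_congr rfl fun j _ => by ring
  obtain ⟨V, hV⟩ := exists_warpedForm_eq (GF := GF) (f := f) (hnd _ hu.1) hlam
    (fun j => fderiv ℝ (fun b => fderiv ℝ (f j) b x.1) u.1 z.1 • y.2 j +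
      fderiv ℝ (fun b => fderiv ℝ (f j) b y.1) u.1 z.1 • x.2 j +
      fderiv ℝ (f j) u.1 x.1 • v j (z.2 j) (y.2 j) +
      fderiv ℝ (f j) u.1 y.1 • v j (z.2 j) (x.2 j) +
      fderiv ℝ (f j) u.1 z.1 • v j (x.2 j) (y.2 j) +
      fderiv ℝ (f j) u.1 (β u) • z.2 j + f j u.1 • R j)
  refine ⟨V, fun w => ?_⟩
  rw [← hV]
  simp only [map_add, map_smul, add_apply, smul_apply, smul_eq_mul, ← hv, ← hR]
  rfl

/-- A multiply warped product of a non-degenerate base with semi-regular fibres is semi-regular,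
in charts. -/
theorem chartSemiRegular_warpedForm [FiniteDimensional ℝ EB]
    [∀ j, FiniteDimensional ℝ (EF j)] (hUB : IsOpen UB) (hUF : ∀ j, IsOpen (UF j))
    (hB : ∀ b ∈ UB, ContDiffAt ℝ ∞ GB b) (hBs : ∀ b ∈ UB, ∀ x y, GB b x y = GB b y x)
    (hnd : ∀ b ∈ UB, ∀ x, (∀ y, GB b x y = 0) → x = 0)
    (hF : ∀ j, ChartSemiRegular (GF j) (UF j) (SF j))
    (hf : ∀ j, ∀ b ∈ UB, ContDiffAt ℝ ∞ (f j) b)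
    (hS : ∀ u ∈ productDomain UB UF, u ∈ S → ∀ j, f j =ᶠ[𝓝 u.1] 0 ∨ GF j =ᶠ[𝓝 (u.2 j)] 0 ∨
      (f j u.1 ≠ 0 ∧ u.2 j ∈ SF j)) :
    ChartSemiRegular (warpedForm GB GF f) (productDomain UB UF) S := by
  have hWs : ∀ u ∈ productDomain UB UF, ContDiffAt ℝ ∞ (warpedForm GB GF f) u := fun u hu =>
    contDiffAt_warpedForm (hB _ hu.1) (fun j => (hF j).smooth _ (hu.2 j)) (fun j => hf j _ hu.1)
  refine ⟨hWs, ?_, fun u hu x y => exists_christoffel_warpedForm_eq hB hnd hF hf hu x y, ?_⟩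
  · intro u hu x y
    rw [warpedForm_apply, warpedForm_apply, hBs _ hu.1]
    congr 1
    exact Finset.sum_congr rfl fun j _ => by rw [(hF j).symm _ (hu.2 j)]
  intro x y z
  choose r hr1 hr2 hr3 using fun j => (hF j).exists_extension (x.2 j) (y.2 j) (z.2 j)
  have hbase : ∀ u ∈ productDomain UB UF, ∀ (x y : EB × ∀ j, EF j) b,
      christoffel (warpedForm GB GF f) u x y (b, 0) = christoffel GB u.1 x.1 y.1 b -
      ∑ j, f j u.1 * fderiv ℝ (f j) u.1 b * GF j (u.2 j) (x.2 j) (y.2 j) := fun u hu x y b =>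
    christoffel_warpedForm_base ((hWs u hu).differentiableAt (by simp))
      ((hB _ hu.1).differentiableAt (by simp))
      (fun j => ((hF j).smooth _ (hu.2 j)).differentiableAt (by simp))
      (fun j => (hf j _ hu.1).differentiableAt (by simp)) x y b
  -- Only the base component of a raised Christoffel symbol can be chosen smoothly, because only the
  -- base metric is known to be invertible.
  obtain ⟨β, hβ⟩ := exists_raise (U := productDomain UB UF)
    (G := fun u : EB × ∀ j, EF j => GB u.1)
    (α := fun u b => christoffel (warpedForm GB GF f) u x y (b, 0))
    (fun u hu => (hB _ hu.1).comp u contDiffAt_fst) (fun u hu => hnd _ hu.1)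
    (fun u hu b => contDiffAt_christoffel (hWs u hu) contDiffAt_const contDiffAt_const
      contDiffAt_const)
    (fun u hu => by
      constructor
      · intro b b'
        rw [← christoffel_add_right]; simp
      · intro c b
        rw [smul_eq_mul, ← christoffel_smul_right]; simp)
  refine ⟨warpedExtension GB GF f β r x y z, ?_, ?_, ?_⟩
  · intro u hu w
    exact contDiffAt_warpedExtension (hB _ hu.1) (fun j => (hF j).smooth _ (hu.2 j))
      (fun j => hf j _ hu.1) (hβ u hu).1 (fun j w => hr1 j _ (hu.2 j) w) x y z w
  · intro u hu
    exact exists_warpedExtension_eq hB hnd hF hf β hr2 hu x y z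
  intro u hu huS w a b ha hb
  -- Representatives are unique only modulo the kernel of the warped form, but non-degeneracy of the
  -- base fixes their base component.
  have hb1 : b.1 = β u := by
    refine sub_eq_zero.1 (hnd _ hu.1 _ fun c => ?_)
    rw [map_sub, sub_apply, (hβ u hu).2 c, hb, warpedForm_apply_base, sub_self]
  have hab : GB u.1 a.1 b.1 = christoffel GB u.1 z.1 w.1 (β u) -
      ∑ j, f j u.1 * fderiv ℝ (f j) u.1 (β u) * GF j (u.2 j) (z.2 j) (w.2 j) := by
    rw [← hbase u hu, ha, warpedForm_apply_base, hb1]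
  have hfib : ∀ (x y v : EB × ∀ j, EF j), (∀ w', christoffel (warpedForm GB GF f) u x y w' =
      warpedForm GB GF f u v w') → ∀ j (c : EF j), f j u.1 ^ 2 * GF j (u.2 j) (v.2 j) c =
      f j u.1 * (fderiv ℝ (f j) u.1 x.1 * GF j (u.2 j) (y.2 j) c +
          fderiv ℝ (f j) u.1 y.1 * GF j (u.2 j) c (x.2 j)) +
        f j u.1 ^ 2 * christoffel (GF j) (u.2 j) (x.2 j) (y.2 j) c := by
    intro x y v h j c
    rw [← warpedForm_apply_fiber, ← h]
    exact christoffel_warpedForm_fiber ((hWs u hu).differentiableAt (by simp))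
      ((hB _ hu.1).differentiableAt (by simp))
      (fun j => ((hF j).smooth _ (hu.2 j)).differentiableAt (by simp))
      (fun j => (hf j _ hu.1).differentiableAt (by simp)) x y j c
  rw [fderiv_christoffel_warpedForm hUB hUF hB (fun j => (hF j).smooth) hf hu, warpedForm_apply,
    hab, warpedExtension]
  rw [show ∀ A B C D X Y Z : ℝ, A - B - C + D = A + X - (B - Y + Z) ↔ D - C = X + Y - Z from
    fun A B C D X Y Z => by constructor <;> intro h <;> linarith]
  rw [← Finset.sum_sub_distrib, ← Finset.sum_add_distrib, ← Finset.sum_sub_distrib]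
  refine Finset.sum_congr rfl fun j _ => ?_
  rcases hS u hu huS j with h | h | ⟨h1, h2⟩
  -- Second derivatives of `f j` occur only multiplied by `f j`, so the vanishing of `f j` and of
  -- its first derivative at `u.1` suffices.
  · have e1 : f j u.1 = 0 := h.self_of_nhds
    have e2 : fderiv ℝ (f j) u.1 = 0 := by rw [h.fderiv_eq]; simp
    simp [e1, e2]
  -- Here `f j` may vanish at `u.1` without vanishing nearby. The extension `r j` vanishes as well,
  -- because it lies in the range of the zero form.
  · have e1 : GF j (u.2 j) = 0 := h.self_of_nhds
    have e2 : fderiv ℝ (GF j) (u.2 j) = 0 := by rw [h.fderiv_eq]; simp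
    have e3 : ∀ a c d, christoffel (GF j) (u.2 j) a c d = 0 := by simp [christoffel, e2]
    have e4 : fderiv ℝ (fun c => christoffel (GF j) c (x.2 j) (y.2 j) (w.2 j)) (u.2 j) = 0 := by
      have : (fun c => christoffel (GF j) c (x.2 j) (y.2 j) (w.2 j)) =ᶠ[𝓝 (u.2 j)] 0 := by
        filter_upwards [h.fderiv (𝕜 := ℝ)] with c hc
        simp [christoffel, hc]
      rw [this.fderiv_eq]; simp
    have e5 : r j (u.2 j) (w.2 j) = 0 := by
      obtain ⟨v, hv⟩ := hr2 j (u.2 j) (hu.2 j)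
      rw [hv, e1]; simp
    simp [e1, e2, e3, e4, e5]
  · have key := fiber_identity (G := fun a c => GF j (u.2 j) a c) (by simp) (by simp)
      ((hF j).symm _ (hu.2 j)) (isLinearMap_christoffel (G := GF j) (z.2 j) (w.2 j)) h1
      (hfib z w a ha j) (hfib x y b hb j)
      (fun a' b' ha' hb' => hr3 j _ (hu.2 j) h2 (w.2 j) a' b' ha' hb')
    rw [key]
    have hd : DifferentiableAt ℝ (GF j) (u.2 j) :=
      ((hF j).smooth _ (hu.2 j)).differentiableAt (by simp)
    have hs : ∀ᶠ c in 𝓝 (u.2 j), ∀ x y, GF j c x y = GF j c y x := by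
      filter_upwards [(hUF j).mem_nhds (hu.2 j)] with c hc using (hF j).symm c hc
    -- Derivatives of `GF j` are traded for Christoffel symbols, in which both sides become the same
    -- polynomial.
    rw [← christoffel_add_christoffel hd hs (z.2 j) (y.2 j) (w.2 j),
      fderiv_apply_symm hd hs (z.2 j) (w.2 j) (x.2 j),
      ← christoffel_add_christoffel hd hs (z.2 j) (x.2 j) (w.2 j),
      (hF j).symm _ (hu.2 j) (w.2 j) (x.2 j), (hF j).symm _ (hu.2 j) (w.2 j) (y.2 j)]
    ring

end WarpedSemiRegular

/-! ### Coordinate frames, vector fields and tensor fields in a chart -/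

section Chart

variable {E : Type*} [NormedAddCommGroup E] [NormedSpace ℝ E]
  {H : Type*} [TopologicalSpace H] {I : ModelWithCorners ℝ E H}
  {M : Type*} [TopologicalSpace M] [ChartedSpace H M]

/-- The coordinate frame of the chart at `p₀`, as a linear map into the tangent space. -/
noncomputable def chartFrame (I : ModelWithCorners ℝ E H) (p₀ : M) (u : E) :
    E →L[ℝ] TangentSpace I ((extChartAt I p₀).symm u) :=
  mfderiv 𝓘(ℝ, E) I (extChartAt I p₀).symm u

/-- The coordinate expression of a field of bilinear forms in the chart at `p₀`. -/
noncomputable def chartForm (g : FormField I M) (p₀ : M) (u : E) : E →L[ℝ] E →L[ℝ] ℝ :=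
  ContinuousLinearMap.bilinearComp (E := E) (F := E) (E' := E) (F' := E)
    (g ((extChartAt I p₀).symm u)) (chartFrame I p₀ u) (chartFrame I p₀ u)

theorem chartForm_apply (g : FormField I M) (p₀ : M) (u x y : E) :
    chartForm g p₀ u x y = g _ (chartFrame I p₀ u x) (chartFrame I p₀ u y) := rfl

/-- The coordinate expression of a vector field in the chart at `p₀`. -/
noncomputable def chartField (p₀ : M) (X : ∀ p : M, TangentSpace I p) (u : E) : E :=
  VectorField.mpullback 𝓘(ℝ, E) I (extChartAt I p₀).symm X u

/-- The vector field with constant coordinates `w` in the chart at `p₀`. -/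
noncomputable def coordField (I : ModelWithCorners ℝ E H) (p₀ : M) (w : E) (p : M) :
    TangentSpace I p :=
  VectorField.mpullback I 𝓘(ℝ, E) (extChartAt I p₀) (fun _ => w) p

variable [IsManifold I ∞ M] {p₀ : M} {u : E}

theorem isManifold_of_infty (n : ℕ) (M : Type*) [TopologicalSpace M] [ChartedSpace H M]
    [IsManifold I ∞ M] : IsManifold I n M := IsManifold.of_le (n := ∞) (by exact_mod_cast le_top)

theorem contMDiffAt_extChartAt_symm [I.Boundaryless] (hu : u ∈ (extChartAt I p₀).target) :
    ContMDiffAt 𝓘(ℝ, E) I ∞ (extChartAt I p₀).symm u :=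
  (contMDiffOn_extChartAt_symm p₀).contMDiffAt ((isOpen_extChartAt_target p₀).mem_nhds hu)

theorem isInvertible_chartFrame [I.Boundaryless] (hu : u ∈ (extChartAt I p₀).target) :
    (chartFrame I p₀ u).IsInvertible := by
  have : IsManifold I 1 M := isManifold_of_infty 1 M
  have h := isInvertible_mfderivWithin_extChartAt_symm hu
  rw [I.range_eq_univ, mfderivWithin_univ] at h
  exact h

theorem chartFrame_chartField [I.Boundaryless] (hu : u ∈ (extChartAt I p₀).target)
    (X : ∀ p : M, TangentSpace I p) :
    chartFrame I p₀ u (chartField p₀ X u) = X ((extChartAt I p₀).symm u) := by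
  obtain ⟨e, he⟩ := isInvertible_chartFrame (I := I) hu
  have h : chartField p₀ X u = (chartFrame I p₀ u).inverse (X ((extChartAt I p₀).symm u)) := rfl
  rw [h, ← he, ContinuousLinearMap.inverse_equiv]
  exact e.apply_symm_apply _

theorem chartFrame_injective [I.Boundaryless] (hu : u ∈ (extChartAt I p₀).target) :
    Function.Injective (chartFrame I p₀ u) := by
  obtain ⟨e, he⟩ := isInvertible_chartFrame (I := I) hu
  rw [← he]
  exact e.injective

theorem chartFrame_surjective [I.Boundaryless] (hu : u ∈ (extChartAt I p₀).target) :
    Function.Surjective (chartFrame I p₀ u) := by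
  obtain ⟨e, he⟩ := isInvertible_chartFrame (I := I) hu
  rw [← he]
  exact e.surjective

theorem coordField_symm [I.Boundaryless] (hu : u ∈ (extChartAt I p₀).target) (w : E) :
    coordField I p₀ w ((extChartAt I p₀).symm u) = chartFrame I p₀ u w := by
  have : IsManifold I 1 M := isManifold_of_infty 1 M
  have h1 := mfderivWithin_extChartAt_symm_comp_mfderiv_extChartAt hu
  have h2 := mfderiv_extChartAt_comp_mfderivWithin_extChartAt_symm hu
  rw [I.range_eq_univ, mfderivWithin_univ] at h1 h2
  have h3 : (mfderiv I 𝓘(ℝ, E) (extChartAt I p₀) ((extChartAt I p₀).symm u)).inverse =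
      chartFrame I p₀ u := ContinuousLinearMap.inverse_eq h2 h1
  rw [← h3]
  rfl

theorem chartField_coordField [I.Boundaryless] (hu : u ∈ (extChartAt I p₀).target) (w : E) :
    chartField p₀ (coordField I p₀ w) u = w :=
  chartFrame_injective hu (by rw [chartFrame_chartField hu, coordField_symm hu])

theorem contMDiffAt_coordField [CompleteSpace E] {p : M} (hp : p ∈ (chartAt H p₀).source) (w : E) :
    ContMDiffAt I I.tangent ∞ (fun q => (⟨q, coordField I p₀ w q⟩ : TangentBundle I M)) p := by
  have : IsManifold I 1 M := isManifold_of_infty 1 M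
  refine ContMDiffAt.mpullback_vectorField_preimage (n := ∞) (I' := 𝓘(ℝ, E))
    (f := extChartAt I p₀) (V := fun _ => w) ?_ (contMDiffAt_extChartAt' hp)
    (isInvertible_mfderiv_extChartAt (by simpa using hp)) (by simp)
  exact contMDiffAt_vectorSpace_iff_contDiffAt.2 contDiffAt_const

theorem contDiffAt_chartField [CompleteSpace E] [I.Boundaryless]
    (hu : u ∈ (extChartAt I p₀).target) {X : ∀ p : M, TangentSpace I p}
    (hX : ContMDiffAt I I.tangent ∞ (fun q => (⟨q, X q⟩ : TangentBundle I M))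
      ((extChartAt I p₀).symm u)) : ContDiffAt ℝ ∞ (chartField p₀ X) u := by
  have : IsManifold I 1 M := isManifold_of_infty 1 M
  have hi := isInvertible_chartFrame (E := E) (I := I) hu
  have h := ContMDiffAt.mpullback_vectorField_preimage (n := ∞) hX (contMDiffAt_extChartAt_symm hu)
    hi (by simp)
  exact contMDiffAt_vectorSpace_iff_contDiffAt.1 h

theorem chartForm_chartField [I.Boundaryless] (hu : u ∈ (extChartAt I p₀).target)
    (g : FormField I M) (X Y : ∀ p : M, TangentSpace I p) :
    chartForm g p₀ u (chartField p₀ X u) (chartField p₀ Y u) =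
      g ((extChartAt I p₀).symm u) (X _) (Y _) := by
  rw [chartForm_apply, chartFrame_chartField hu, chartFrame_chartField hu]

theorem dirDeriv_symm [I.Boundaryless] (hu : u ∈ (extChartAt I p₀).target)
    (X : ∀ p : M, TangentSpace I p) {h : M → ℝ}
    (hh : MDifferentiableAt I 𝓘(ℝ, ℝ) h ((extChartAt I p₀).symm u)) :
    dirDeriv X h ((extChartAt I p₀).symm u) =
      fderiv ℝ (fun u' => h ((extChartAt I p₀).symm u')) u (chartField p₀ X u) := by
  rw [dirDeriv, ← chartFrame_chartField hu X]
  have := mvfderiv_comp_apply u hh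
    ((contMDiffAt_extChartAt_symm hu).mdifferentiableAt (by simp)) (chartField (E := E) p₀ X u)
  refine this.symm.trans ?_
  change mfderiv 𝓘(ℝ, E) 𝓘(ℝ, ℝ) _ u _ = _
  rw [mfderiv_eq_fderiv]
  rfl

/-- The Lie bracket is natural under pullback by the inverse chart, and on a vector space it is the
commutator of directional derivatives. -/
theorem chartField_mlieBracket [CompleteSpace E] [I.Boundaryless]
    (hu : u ∈ (extChartAt I p₀).target) {X Y : ∀ p : M, TangentSpace I p}
    (hX : MDifferentiableAt I I.tangent (fun q => (⟨q, X q⟩ : TangentBundle I M))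
      ((extChartAt I p₀).symm u))
    (hY : MDifferentiableAt I I.tangent (fun q => (⟨q, Y q⟩ : TangentBundle I M))
      ((extChartAt I p₀).symm u)) :
    chartField p₀ (VectorField.mlieBracket I X Y) u =
      fderiv ℝ (chartField p₀ Y) u (chartField p₀ X u) -
        fderiv ℝ (chartField p₀ X) u (chartField p₀ Y u) := by
  have : IsManifold I (minSmoothness ℝ 2) M := by
    rw [minSmoothness_of_isRCLikeNormedField]; exact isManifold_of_infty 2 M
  have h := VectorField.mpullback_mlieBracket (n := ∞) hX hY (contMDiffAt_extChartAt_symm hu)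
    (by rw [minSmoothness_of_isRCLikeNormedField]; exact ENat.LEInfty.out)
  refine h.trans ?_
  rw [← VectorField.mlieBracketWithin_univ, VectorField.mlieBracketWithin_eq_lieBracketWithin]
  exact congrFun (VectorField.lieBracketWithin_univ (𝕜 := ℝ) (V := chartField p₀ X)
    (W := chartField p₀ Y)) u

end Chart

section ChartSmooth

variable {E : Type*} [NormedAddCommGroup E] [NormedSpace ℝ E]
  {H : Type*} [TopologicalSpace H] {I : ModelWithCorners ℝ E H}
  {M : Type*} [TopologicalSpace M] [ChartedSpace H M] {p₀ : M} {u : E}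

theorem symm_mem_chart_source (hu : u ∈ (extChartAt I p₀).target) :
    (extChartAt I p₀).symm u ∈ (chartAt H p₀).source := by
  have := (extChartAt I p₀).map_target hu
  rwa [extChartAt_source] at this

theorem eventually_exists_symm (p₀ : M) :
    ∀ᶠ p in 𝓝 p₀, ∃ u ∈ (extChartAt I p₀).target, p = (extChartAt I p₀).symm u := by
  filter_upwards [extChartAt_source_mem_nhds (I := I) p₀] with p hp
  exact ⟨_, (extChartAt I p₀).map_source hp, ((extChartAt I p₀).left_inv hp).symm⟩

variable [IsManifold I ∞ M]

theorem contMDiffAt_pairing {g : FormField I M} (hg : IsSingularMetric g)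
    {Y Z : ∀ p : M, TangentSpace I p} {p : M}
    (hY : ContMDiffAt I I.tangent ∞ (fun q => (⟨q, Y q⟩ : TangentBundle I M)) p)
    (hZ : ContMDiffAt I I.tangent ∞ (fun q => (⟨q, Z q⟩ : TangentBundle I M)) p) :
    ContMDiffAt I 𝓘(ℝ, ℝ) ∞ (fun q => g q (Y q) (Z q)) p := by
  have h : ContMDiffAt I (I.prod 𝓘(ℝ)) ∞
      (fun m => Bundle.TotalSpace.mk' ℝ (E := Bundle.Trivial M ℝ) m (g m (Y m) (Z m))) p := by
    apply ContMDiffAt.clm_bundle_apply₂ (F₁ := E) (F₂ := E)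
    · exact hg.smooth p
    · exact hY
    · exact hZ
  simp only [Bundle.contMDiffAt_totalSpace] at h
  exact h.2

theorem contMDiffAt_oneForm_apply {η : CovectorField I M} (hη : IsSmoothOneForm η)
    {Z : ∀ p : M, TangentSpace I p} {p : M}
    (hZ : ContMDiffAt I I.tangent ∞ (fun q => (⟨q, Z q⟩ : TangentBundle I M)) p) :
    ContMDiffAt I 𝓘(ℝ, ℝ) ∞ (fun q => η q (Z q)) p := by
  have h : ContMDiffAt I (I.prod 𝓘(ℝ)) ∞
      (fun m => Bundle.TotalSpace.mk' ℝ (E := Bundle.Trivial M ℝ) m (η m (Z m))) p := by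
    apply ContMDiffAt.clm_bundle_apply (F₁ := E)
    · exact hη p
    · exact hZ
  simp only [Bundle.contMDiffAt_totalSpace] at h
  exact h.2

variable [I.Boundaryless]

/-- The preferred trivialization of the tangent bundle is the derivative of the chart. This turns
smoothness of sections of the tensor bundles into smoothness of components in the coordinate frame.
-/
theorem symmL_trivializationAt_symm (hu : u ∈ (extChartAt I p₀).target) (w : E) :
    (trivializationAt E (TangentSpace I) p₀).symmL ℝ ((extChartAt I p₀).symm u) w =
      chartFrame I p₀ u w := by
  have : IsManifold I 1 M := isManifold_of_infty 1 M
  have hs := symm_mem_chart_source hu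
  have hb : (extChartAt I p₀).symm u ∈ (trivializationAt E (TangentSpace I) p₀).baseSet := by
    simpa using hs
  have h1 := TangentBundle.continuousLinearMapAt_trivializationAt (I := I) hs
  have h2 := mfderiv_extChartAt_comp_mfderivWithin_extChartAt_symm hu
  rw [I.range_eq_univ, mfderivWithin_univ] at h2
  have h3 := (trivializationAt E (TangentSpace I) p₀).symmL_continuousLinearMapAt (R := ℝ) hb
    (chartFrame I p₀ u w)
  rw [← h3, h1]
  congr 1
  exact (congrArg (fun L => L w) h2).symm

theorem contDiffAt_comp_symm {F : Type*} [NormedAddCommGroup F] [NormedSpace ℝ F]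
    {h : M → F} (hu : u ∈ (extChartAt I p₀).target)
    (hh : ContMDiffAt I 𝓘(ℝ, F) ∞ h ((extChartAt I p₀).symm u)) :
    ContDiffAt ℝ ∞ (fun u' => h ((extChartAt I p₀).symm u')) u :=
  (hh.comp u (contMDiffAt_extChartAt_symm hu)).contDiffAt

/-- Smoothness at the centre of each chart is enough, since every point is the centre of its own
preferred chart. -/
theorem isSingularMetric_of_chart {g : FormField I M}
    (hs : ∀ (p : M) (x y : TangentSpace I p), g p x y = g p y x)
    (h : ∀ p₀ : M, ContDiffAt ℝ ∞ (chartForm g p₀) (extChartAt I p₀ p₀)) :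
    IsSingularMetric g := by
  refine ⟨hs, fun p₀ => ?_⟩
  refine (contMDiffAt_hom_bundle _).2 ⟨contMDiffAt_id, ?_⟩
  have h1 : ContMDiffAt I 𝓘(ℝ, E →L[ℝ] E →L[ℝ] ℝ) ∞
      (fun p => chartForm g p₀ (extChartAt I p₀ p)) p₀ :=
    ContMDiffAt.comp (g := chartForm g p₀) p₀ (h p₀).contMDiffAt contMDiffAt_extChartAt
  refine h1.congr_of_eventuallyEq ?_
  filter_upwards [eventually_exists_symm (I := I) p₀] with p hp
  obtain ⟨u, hu, rfl⟩ := hp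
  have hb : (extChartAt I p₀).symm u ∈ (trivializationAt E (TangentSpace I) p₀).baseSet := by
    simpa using symm_mem_chart_source hu
  ext x y
  refine (inCoordinates_apply_eq₂ (𝕜 := ℝ) (E₃ := Bundle.Trivial M ℝ) hb hb (by trivial)).trans ?_
  rw [(extChartAt I p₀).right_inv hu, chartForm_apply, ← symmL_trivializationAt_symm hu,
    ← symmL_trivializationAt_symm hu, Bundle.Trivialization.symmL_apply _ hb,
    Bundle.Trivialization.symmL_apply _ hb]
  exact congrArg (fun L : ℝ →ₗ[ℝ] ℝ => L _)
    (Bundle.Trivial.linearMapAt_trivialization ℝ M ℝ ((extChartAt I p₀).symm u))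

variable [FiniteDimensional ℝ E]

theorem contDiffAt_chartForm {g : FormField I M} (hg : IsSingularMetric g)
    (hu : u ∈ (extChartAt I p₀).target) : ContDiffAt ℝ ∞ (chartForm g p₀) u := by
  have : CompleteSpace E := FiniteDimensional.complete ℝ E
  refine contDiffAt_clm_of_apply fun x => contDiffAt_clm_of_apply fun y => ?_
  have hs := symm_mem_chart_source hu
  refine (contDiffAt_comp_symm hu (contMDiffAt_pairing hg (contMDiffAt_coordField hs x)
    (contMDiffAt_coordField hs y))).congr_of_eventuallyEq ?_
  filter_upwards [(isOpen_extChartAt_target p₀).mem_nhds hu] with u' hu'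
  rw [chartForm_apply, coordField_symm hu', coordField_symm hu']

theorem contDiffAt_oneForm_chartFrame {η : CovectorField I M} (hη : IsSmoothOneForm η)
    (hu : u ∈ (extChartAt I p₀).target) (w : E) :
    ContDiffAt ℝ ∞ (fun u' => η ((extChartAt I p₀).symm u') (chartFrame I p₀ u' w)) u := by
  have : CompleteSpace E := FiniteDimensional.complete ℝ E
  have hs := symm_mem_chart_source hu
  refine (contDiffAt_comp_symm hu
    (contMDiffAt_oneForm_apply hη (contMDiffAt_coordField hs w))).congr_of_eventuallyEq ?_
  filter_upwards [(isOpen_extChartAt_target p₀).mem_nhds hu] with u' hu'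
  rw [coordField_symm hu']

theorem isSmoothOneForm_of_chart {η : CovectorField I M}
    (h : ∀ (p₀ : M) (w : E), ContDiffAt ℝ ∞
      (fun u' => η ((extChartAt I p₀).symm u') (chartFrame I p₀ u' w)) (extChartAt I p₀ p₀)) :
    IsSmoothOneForm η := by
  intro p₀
  refine (contMDiffAt_hom_bundle _).2 ⟨contMDiffAt_id, ?_⟩
  let c : E → E →L[ℝ] ℝ := fun u =>
    ContinuousLinearMap.comp (M₂ := E) (η ((extChartAt I p₀).symm u)) (chartFrame I p₀ u)
  have h0 : ContDiffAt ℝ ∞ c (extChartAt I p₀ p₀) := contDiffAt_clm_of_apply (h p₀)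
  have h1 : ContMDiffAt I 𝓘(ℝ, E →L[ℝ] ℝ) ∞ (fun p => c (extChartAt I p₀ p)) p₀ :=
    ContMDiffAt.comp (g := c) p₀ h0.contMDiffAt contMDiffAt_extChartAt
  refine h1.congr_of_eventuallyEq ?_
  filter_upwards [eventually_exists_symm (I := I) p₀] with p hp
  obtain ⟨u, hu, rfl⟩ := hp
  have hb : (extChartAt I p₀).symm u ∈ (trivializationAt E (TangentSpace I) p₀).baseSet := by
    simpa using symm_mem_chart_source hu
  ext x
  rw [(extChartAt I p₀).right_inv hu]
  change _ = η ((extChartAt I p₀).symm u) (chartFrame I p₀ u x)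
  rw [← symmL_trivializationAt_symm hu]
  simp [ContinuousLinearMap.inCoordinates]
  rfl

end ChartSmooth

/-! ### The Koszul form in a chart -/

section KoszulChart

variable {E : Type*} [NormedAddCommGroup E] [NormedSpace ℝ E]
  {H : Type*} [TopologicalSpace H] {I : ModelWithCorners ℝ E H}
  {M : Type*} [TopologicalSpace M] [ChartedSpace H M] [IsManifold I ∞ M] {p₀ : M} {u : E}

theorem fderiv_pairing {G : E → E →L[ℝ] E →L[ℝ] ℝ} {Y Z : E → E} (hG : DifferentiableAt ℝ G u)
    (hY : DifferentiableAt ℝ Y u) (hZ : DifferentiableAt ℝ Z u) (x : E) :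
    fderiv ℝ (fun u' => G u' (Y u') (Z u')) u x =
      fderiv ℝ G u x (Y u) (Z u) + G u (fderiv ℝ Y u x) (Z u) + G u (Y u) (fderiv ℝ Z u x) := by
  have h : HasFDerivAt (fun u' => G u' (Y u') (Z u')) _ u :=
    (hG.hasFDerivAt.clm_apply hY.hasFDerivAt).clm_apply hZ.hasFDerivAt
  rw [h.fderiv]
  simp
  ring

theorem chartForm_symm {g : FormField I M} (hg : IsSingularMetric g) (u x y : E) :
    chartForm g p₀ u x y = chartForm g p₀ u y x := by
  rw [chartForm_apply, hg.symm, chartForm_apply]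

variable [I.Boundaryless] [FiniteDimensional ℝ E]

theorem dirDeriv_pairing_symm {g : FormField I M} (hg : IsSingularMetric g)
    {X Y Z : ∀ p : M, TangentSpace I p} (hu : u ∈ (extChartAt I p₀).target)
    (hY : ContMDiffAt I I.tangent ∞ (fun q => (⟨q, Y q⟩ : TangentBundle I M))
      ((extChartAt I p₀).symm u))
    (hZ : ContMDiffAt I I.tangent ∞ (fun q => (⟨q, Z q⟩ : TangentBundle I M))
      ((extChartAt I p₀).symm u)) :
    dirDeriv X (fun q => g q (Y q) (Z q)) ((extChartAt I p₀).symm u) =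
      fderiv ℝ (chartForm g p₀) u (chartField p₀ X u) (chartField p₀ Y u) (chartField p₀ Z u) +
      chartForm g p₀ u (fderiv ℝ (chartField p₀ Y) u (chartField p₀ X u)) (chartField p₀ Z u) +
      chartForm g p₀ u (chartField p₀ Y u)
        (fderiv ℝ (chartField p₀ Z) u (chartField p₀ X u)) := by
  have : CompleteSpace E := FiniteDimensional.complete ℝ E
  rw [dirDeriv_symm hu X ((contMDiffAt_pairing hg hY hZ).mdifferentiableAt (by simp)),
    ← fderiv_pairing ((contDiffAt_chartForm hg hu).differentiableAt (by simp))
      ((contDiffAt_chartField hu hY).differentiableAt (by simp))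
      ((contDiffAt_chartField hu hZ).differentiableAt (by simp))]
  congr 1
  apply Filter.EventuallyEq.fderiv_eq
  filter_upwards [(isOpen_extChartAt_target p₀).mem_nhds hu] with u' hu'
  rw [chartForm_chartField hu']

/-- The derivatives of the components of `X` and `Z` produced by the product rule cancel against
those from the brackets; only the derivative of `Y` along `X` survives. -/
theorem koszul_symm {g : FormField I M} (hg : IsSingularMetric g)
    {X Y Z : ∀ p : M, TangentSpace I p} (hu : u ∈ (extChartAt I p₀).target)
    (hX : ContMDiffAt I I.tangent ∞ (fun q => (⟨q, X q⟩ : TangentBundle I M))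
      ((extChartAt I p₀).symm u))
    (hY : ContMDiffAt I I.tangent ∞ (fun q => (⟨q, Y q⟩ : TangentBundle I M))
      ((extChartAt I p₀).symm u))
    (hZ : ContMDiffAt I I.tangent ∞ (fun q => (⟨q, Z q⟩ : TangentBundle I M))
      ((extChartAt I p₀).symm u)) :
    koszul g X Y Z ((extChartAt I p₀).symm u) =
      chartForm g p₀ u (fderiv ℝ (chartField p₀ Y) u (chartField p₀ X u)) (chartField p₀ Z u) +
      christoffel (chartForm g p₀) u (chartField p₀ X u) (chartField p₀ Y u)
        (chartField p₀ Z u) := by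
  have : CompleteSpace E := FiniteDimensional.complete ℝ E
  have hX' := hX.mdifferentiableAt (by simp)
  have hY' := hY.mdifferentiableAt (by simp)
  have hZ' := hZ.mdifferentiableAt (by simp)
  rw [koszul, dirDeriv_pairing_symm hg hu hY hZ, dirDeriv_pairing_symm hg hu hZ hX,
    dirDeriv_pairing_symm hg hu hX hY, ← chartForm_chartField hu g X,
    ← chartForm_chartField hu g Y, ← chartForm_chartField hu g Z,
    chartField_mlieBracket hu hY' hZ', chartField_mlieBracket hu hZ' hX',
    chartField_mlieBracket hu hX' hY', christoffel]
  simp only [map_sub]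
  rw [chartForm_symm hg u (fderiv ℝ (chartField p₀ Y) u (chartField p₀ X u)),
    chartForm_symm hg u (fderiv ℝ (chartField p₀ Z) u (chartField p₀ Y u)),
    chartForm_symm hg u (fderiv ℝ (chartField p₀ X) u (chartField p₀ Z u))]
  ring

/-- The coordinate field is smooth only on the chart domain, but tensoriality in the last slot asks
for no more than differentiability at the point. -/
theorem lowerCovDeriv_symm {g : FormField I M} (hg : IsSingularMetric g)
    {X Y : ∀ p : M, TangentSpace I p} (hu : u ∈ (extChartAt I p₀).target)
    (hX : IsSmoothVectorField X) (hY : IsSmoothVectorField Y) (w : E) :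
    lowerCovDeriv g X Y ((extChartAt I p₀).symm u) (chartFrame I p₀ u w) =
      chartForm g p₀ u (fderiv ℝ (chartField p₀ Y) u (chartField p₀ X u)) w +
      christoffel (chartForm g p₀) u (chartField p₀ X u) (chartField p₀ Y u) w := by
  have : CompleteSpace E := FiniteDimensional.complete ℝ E
  have hw := contMDiffAt_coordField (I := I) (symm_mem_chart_source hu) w
  rw [lowerCovDeriv, dif_pos (koszul_tensorialAt hg hX hY _), ← coordField_symm hu,
    TensorialAt.mkHom_apply _ (hw.mdifferentiableAt (by simp)),
    koszul_symm hg hu (hX _) (hY _) hw, chartField_coordField hu]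

end KoszulChart

/-! ### From a semi-regular manifold to its charts -/

section Forward

variable {E : Type*} [NormedAddCommGroup E] [NormedSpace ℝ E] [FiniteDimensional ℝ E]
  {H : Type*} [TopologicalSpace H] {I : ModelWithCorners ℝ E H} [I.Boundaryless]
  {M : Type*} [TopologicalSpace M] [ChartedSpace H M] [IsManifold I ∞ M] {p₀ : M} {u : E}

/-- Coordinate vector fields can be cut off to global smooth vector fields, uniformly in a
neighbourhood of the centre of the chart. -/
theorem exists_global_coordField [T2Space M] (p₀ : M) :
    ∃ (U : Set E) (X : E → ∀ p : M, TangentSpace I p), IsOpen U ∧ extChartAt I p₀ p₀ ∈ U ∧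
      U ⊆ (extChartAt I p₀).target ∧ (∀ x, IsSmoothVectorField (X x)) ∧
      ∀ u ∈ U, ∀ x, chartField p₀ (X x) u = x := by
  have : CompleteSpace E := FiniteDimensional.complete ℝ E
  let ψ : SmoothBumpFunction I p₀ := Classical.arbitrary _
  have h1 : ∀ᶠ u in 𝓝 (extChartAt I p₀ p₀), ψ ((extChartAt I p₀).symm u) = 1 := by
    have hc : Filter.Tendsto (extChartAt I p₀).symm (𝓝 (extChartAt I p₀ p₀)) (𝓝 p₀) := by
      have := (continuousAt_extChartAt_symm (I := I) p₀).tendsto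
      rwa [extChartAt_to_inv] at this
    exact hc.eventually ψ.eventuallyEq_one
  obtain ⟨U, hU1, hU2, hU3⟩ := mem_nhds_iff.1 (Filter.inter_mem h1
    ((isOpen_extChartAt_target (I := I) p₀).mem_nhds (mem_extChartAt_target p₀)))
  refine ⟨U, fun x => (ψ : M → ℝ) • coordField I p₀ x, hU2, hU3, fun u hu => (hU1 hu).2, ?_, ?_⟩
  · intro x
    refine ContMDiffOn.smul_section_of_tsupport (u := (chartAt H p₀).source)
      ψ.contMDiff.contMDiffOn (chartAt H p₀).open_source ψ.tsupport_subset_chartAt_source ?_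
    exact fun p hp => (contMDiffAt_coordField hp x).contMDiffWithinAt
  · intro u hu x
    have hu' := (hU1 hu).2
    have h2 : ψ ((extChartAt I p₀).symm u) = 1 := (hU1 hu).1
    apply chartFrame_injective hu'
    rw [chartFrame_chartField hu', ← coordField_symm hu']
    simp only [Pi.smul_apply']
    rw [h2, one_smul]

theorem exists_smoothVectorField_eq [T2Space M] (p : M) (v : TangentSpace I p) :
    ∃ X : ∀ p : M, TangentSpace I p, IsSmoothVectorField X ∧ X p = v := by
  obtain ⟨U, X, hU, hpU, hUt, hX, hXu⟩ := exists_global_coordField (I := I) p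
  obtain ⟨w, hw⟩ := chartFrame_surjective (hUt hpU)
    (show TangentSpace I ((extChartAt I p).symm (extChartAt I p p)) from v)
  refine ⟨X w, hX w, ?_⟩
  have h := chartFrame_chartField (hUt hpU) (X w)
  rw [hXu _ hpU, hw] at h
  have e : (extChartAt I p).symm (extChartAt I p p) = p := extChartAt_to_inv p
  -- All tangent spaces are definitionally `E`; stating the equality in `E` permits moving the base
  -- point without a cast.
  have key : ∀ q, q = p → (X w q : E) = v → (X w p : E) = v := by
    rintro q rfl h; exact h
  exact key _ e h.symm

/-- A semi-regular metric is semi-regular in charts. -/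
theorem IsSemiRegular.exists_chartSemiRegular [T2Space M] {g : FormField I M}
    (hg : IsSemiRegular g) (p₀ : M) :
    ∃ U : Set E, IsOpen U ∧ extChartAt I p₀ p₀ ∈ U ∧ U ⊆ (extChartAt I p₀).target ∧
      ChartSemiRegular (chartForm g p₀) U
        {u | ConstSignatureAt g ((extChartAt I p₀).symm u)} := by
  have : CompleteSpace E := FiniteDimensional.complete ℝ E
  obtain ⟨U, X, hU, hpU, hUt, hX, hXu⟩ := exists_global_coordField (I := I) p₀
  have hs := hg.isSingularMetric
  have hXev : ∀ u ∈ U, ∀ x, chartField p₀ (X x) =ᶠ[𝓝 u] fun _ => x := fun u hu x => by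
    filter_upwards [hU.mem_nhds hu] with u' hu' using hXu u' hu' x
  have hlow : ∀ u ∈ U, ∀ x y w, lowerCovDeriv g (X x) (X y) ((extChartAt I p₀).symm u)
      (chartFrame I p₀ u w) = christoffel (chartForm g p₀) u x y w := by
    intro u hu x y w
    rw [lowerCovDeriv_symm hs (hUt hu) (hX x) (hX y), hXu u hu, hXu u hu,
      (hXev u hu y).fderiv_eq]
    simp
  have hlow' : ∀ u ∈ U, ∀ x y a, (∀ w, christoffel (chartForm g p₀) u x y w =
      chartForm g p₀ u a w) → lowerCovDeriv g (X x) (X y) ((extChartAt I p₀).symm u) =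
        g _ (chartFrame I p₀ u a) := by
    intro u hu x y a h
    ext v
    obtain ⟨w, rfl⟩ := chartFrame_surjective (hUt hu) v
    rw [hlow u hu, h, chartForm_apply]
  have hmem : ∀ u ∈ U, ∀ η : CovectorField I M, η ((extChartAt I p₀).symm u) ∈
      radicalAnnihilator g ((extChartAt I p₀).symm u) → ∃ v, ∀ w,
        η ((extChartAt I p₀).symm u) (chartFrame I p₀ u w) = chartForm g p₀ u v w := by
    rintro u hu η ⟨v', hv'⟩
    obtain ⟨v, rfl⟩ := chartFrame_surjective (hUt hu) v'
    exact ⟨v, fun w => by rw [← hv']; rfl⟩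
  refine ⟨U, hU, hpU, hUt, fun u hu => contDiffAt_chartForm hs (hUt hu),
    fun u _ => chartForm_symm hs u, fun u hu x y => ?_, fun x y z => ?_⟩
  · obtain ⟨v, hv⟩ := hmem u hu _ ((hg.isRadicalStationary _ _ (hX x) (hX y)).2 _)
    exact ⟨v, fun w => by rw [← hlow u hu, hv]⟩
  -- On `U` the cut-off fields have constant components, so all derivatives of components vanish,
  -- and the components of `θ` in the coordinate frame are the required extension.
  · obtain ⟨θ, hθ, hθc⟩ := hg.covDeriv_mem _ _ _ (hX x) (hX y) (hX z)
    refine ⟨fun u w => θ ((extChartAt I p₀).symm u) (chartFrame I p₀ u w), fun u hu w =>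
      contDiffAt_oneForm_chartFrame hθ.1 (hUt hu) w, fun u hu => hmem u hu _ (hθ.2 _), ?_⟩
    intro u hu hS w a b ha hb
    have hXw : X w ((extChartAt I p₀).symm u) = chartFrame I p₀ u w := by
      rw [← chartFrame_chartField (hUt hu) (X w), hXu u hu]
    have hη := (hg.isRadicalStationary _ _ (hX x) (hX y)).1
    have h1 := hθc (X w) (hX w) _ hS
    rw [hXw] at h1
    simp only
    rw [h1, covDeriv, dirDeriv_symm (hUt hu) _
      ((contMDiffAt_oneForm_apply hη (hX w _)).mdifferentiableAt (by simp)), hXu u hu,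
      hlow' u hu z w a ha, hlow' u hu x y b hb, coInner_flat _ _ (hs.symm _), ← chartForm_apply]
    congr 2
    apply Filter.EventuallyEq.fderiv_eq
    filter_upwards [hU.mem_nhds hu] with u' hu'
    rw [← hlow u' hu', ← chartFrame_chartField (hUt hu') (X w), hXu u' hu']

end Forward

/-! ### Semicontinuity of the indices of inertia and density of constant signature -/

section Semicontinuity

variable {E : Type*} [NormedAddCommGroup E] [NormedSpace ℝ E]

/-- The quadratic form of a continuous bilinear form. -/
noncomputable def bilinQuad (A : E →L[ℝ] E →L[ℝ] ℝ) : QuadraticForm ℝ E :=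
  LinearMap.BilinMap.toQuadraticMap A.toBilinForm

variable [FiniteDimensional ℝ E]

/-- A maximal positive definite subspace stays positive definite under small perturbations, by
compactness of its unit sphere. The scalar `c` serves to treat both indices at once, with values `1`
and `-1`. -/
theorem eventually_sigPos_smul_le (c : ℝ) (A : E →L[ℝ] E →L[ℝ] ℝ) :
    ∀ᶠ B in 𝓝 A, sigPos (c • bilinQuad A) ≤ sigPos (c • bilinQuad B) := by
  obtain ⟨V, hV, hpos⟩ := exists_finrank_eq_sigPos_and_posDef (c • bilinQuad A)
  have hev : ∀ᶠ B in 𝓝 A, ∀ v ∈ Metric.sphere (0 : V) 1,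
      0 < c * (B : E →L[ℝ] E →L[ℝ] ℝ) v v := by
    refine (isCompact_sphere (0 : V) 1).eventually_forall_of_forall_eventually fun v hv => ?_
    have hc : Continuous fun z : (E →L[ℝ] E →L[ℝ] ℝ) × V => c * z.1 z.2 z.2 := by fun_prop
    refine (hc.tendsto (A, v)).eventually (lt_mem_nhds ?_)
    refine hpos v fun h => ?_
    simp [h] at hv
  filter_upwards [hev] with B hB
  rw [← hV]
  refine le_sigPos_of_posDef _ fun v hv => ?_
  have hn : ‖v‖ ≠ 0 := norm_ne_zero_iff.2 hv
  have h := hB (‖v‖⁻¹ • v)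
    (by rw [mem_sphere_zero_iff_norm, norm_smul, norm_inv, norm_norm, inv_mul_cancel₀ hn])
  change 0 < c * B v v
  simp only [Submodule.coe_smul, map_smul, smul_apply, smul_eq_mul] at h
  have h2 : 0 < ‖v‖⁻¹ := by positivity
  have h3 : 0 < ‖v‖⁻¹ * (‖v‖⁻¹ * (c * B v v)) := by linarith
  exact (mul_pos_iff_of_pos_left h2).1 ((mul_pos_iff_of_pos_left h2).1 h3)

/-- The positive index of inertia is lower semicontinuous. -/
theorem eventually_sigPos_le (A : E →L[ℝ] E →L[ℝ] ℝ) :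
    ∀ᶠ B in 𝓝 A, sigPos (bilinQuad A) ≤ sigPos (bilinQuad B) := by
  simpa using eventually_sigPos_smul_le 1 A

/-- The negative index of inertia is lower semicontinuous. -/
theorem eventually_sigNeg_le (A : E →L[ℝ] E →L[ℝ] ℝ) :
    ∀ᶠ B in 𝓝 A, sigNeg (bilinQuad A) ≤ sigNeg (bilinQuad B) := by
  have e : ∀ B : E →L[ℝ] E →L[ℝ] ℝ, (-1 : ℝ) • bilinQuad B = -bilinQuad B := fun B => by
    ext x; simp
  simpa [e] using eventually_sigPos_smul_le (-1) A

end Semicontinuity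

section Signature

variable {E : Type*} [NormedAddCommGroup E] [NormedSpace ℝ E]
  {H : Type*} [TopologicalSpace H] {I : ModelWithCorners ℝ E H}
  {M : Type*} [TopologicalSpace M] [ChartedSpace H M] [IsManifold I ∞ M]

/-- The sum of the two indices of inertia is the rank. -/
theorem signature_add_finrank_ker [FiniteDimensional ℝ E] {g : FormField I M}
    (hg : IsSingularMetric g) (p : M) :
    sigPos (quadForm g p) + sigNeg (quadForm g p) +
      Module.finrank ℝ (LinearMap.ker (g p).toLinearMap) = Module.finrank ℝ E := by
  have : FiniteDimensional ℝ (TangentSpace I p) := inferInstanceAs (FiniteDimensional ℝ E)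
  have h := QuadraticForm.sigPos_add_sigNeg_add_radical (Q := quadForm g p)
  have hr : (quadForm g p).radical = LinearMap.ker (g p).toLinearMap := by
    ext x
    rw [QuadraticMap.mem_radical_iff', LinearMap.mem_ker]
    have hq : ∀ y, quadForm g p y = g p y y := fun _ => rfl
    simp only [hq]
    constructor
    -- Polarization: the radical of the quadratic form is the kernel of the symmetric bilinear form.
    · rintro ⟨h1, h2⟩
      ext y
      have h3 := h2 y
      have h4 := hg.symm p x y
      simp only [map_add, add_apply] at h3
      change g p x y = 0
      linarith
    · intro hx
      have h1 : ∀ y, g p x y = 0 := fun y => by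
        have := congrArg (fun L => L y) hx
        exact this
      refine ⟨h1 x, fun y => ?_⟩
      simp only [map_add, add_apply]
      rw [hg.symm p y x, h1, h1]
      ring
  rw [hr] at h
  exact h

variable [I.Boundaryless]

theorem quadForm_symm_equivalent (g : FormField I M) {p₀ : M} {u : E}
    (hu : u ∈ (extChartAt I p₀).target) :
    QuadraticMap.Equivalent (bilinQuad (chartForm g p₀ u))
      (quadForm g ((extChartAt I p₀).symm u)) := by
  obtain ⟨e, he⟩ := isInvertible_chartFrame (I := I) hu
  refine ⟨⟨e.toLinearEquiv, fun x => ?_⟩⟩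
  change g _ (e x) (e x) = chartForm g p₀ u x x
  rw [chartForm_apply, ← he]
  rfl

variable [FiniteDimensional ℝ E]

/-- The coordinate frame transports nearby forms to the fixed space `E`, preserving both indices,
where they vary continuously. -/
theorem eventually_signature_le {g : FormField I M} (hg : IsSingularMetric g) (p₀ : M) :
    ∀ᶠ p in 𝓝 p₀, sigPos (quadForm g p₀) ≤ sigPos (quadForm g p) ∧
      sigNeg (quadForm g p₀) ≤ sigNeg (quadForm g p) := by
  have hc : Filter.Tendsto (fun p => chartForm g p₀ (extChartAt I p₀ p)) (𝓝 p₀)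
      (𝓝 (chartForm g p₀ (extChartAt I p₀ p₀))) :=
    (contDiffAt_chartForm hg (mem_extChartAt_target p₀)).continuousAt.tendsto.comp
      (continuousAt_extChartAt p₀)
  have key : ∀ p ∈ (extChartAt I p₀).source,
      sigPos (bilinQuad (chartForm g p₀ (extChartAt I p₀ p))) = sigPos (quadForm g p) ∧
      sigNeg (bilinQuad (chartForm g p₀ (extChartAt I p₀ p))) = sigNeg (quadForm g p) := by
    intro p hp
    have h := quadForm_symm_equivalent g ((extChartAt I p₀).map_source hp)
    have h' := And.intro h.sigPos_eq h.sigNeg_eq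
    rwa [(extChartAt I p₀).left_inv hp] at h'
  have h0 := key p₀ (mem_extChartAt_source p₀)
  filter_upwards [hc.eventually (eventually_sigPos_le _), hc.eventually (eventually_sigNeg_le _),
    extChartAt_source_mem_nhds (I := I) p₀] with p h1 h2 hp
  rw [h0.1, (key p hp).1] at h1
  rw [h0.2, (key p hp).2] at h2
  exact ⟨h1, h2⟩

/-- The points near which the signature is constant are dense. -/
theorem dense_constSignatureAt {g : FormField I M} (hg : IsSingularMetric g) :
    Dense {p | ConstSignatureAt g p} := by
  rw [dense_iff_inter_open]
  intro W hW hne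
  let S : Set ℕ := (fun p => sigPos (quadForm g p) + sigNeg (quadForm g p)) '' W
  have hbdd : BddAbove S := by
    refine ⟨Module.finrank ℝ E + Module.finrank ℝ E, ?_⟩
    rintro _ ⟨p, _, rfl⟩
    exact add_le_add (sigPos_le_finrank _) (sigPos_le_finrank _)
  -- At a point of `W` where the rank is maximal, neither index can increase nearby, and by
  -- semicontinuity neither can decrease.
  obtain ⟨p, hpW, hp⟩ := Nat.sSup_mem (hne.image _) hbdd
  refine ⟨p, hpW, ?_⟩
  filter_upwards [eventually_signature_le hg p, hW.mem_nhds hpW] with q hq hqW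
  have h2 : sigPos (quadForm g q) + sigNeg (quadForm g q) ≤ sSup S :=
    le_csSup hbdd ⟨q, hqW, rfl⟩
  simp only at hp
  rw [← hp] at h2
  omega

/-- Neither index can drop nearby, so constancy of their sum forces constancy of each. -/
theorem constSignatureAt_of_eventually_add {g : FormField I M} (hg : IsSingularMetric g) {p : M}
    (h : ∀ᶠ q in 𝓝 p, sigPos (quadForm g q) + sigNeg (quadForm g q) =
      sigPos (quadForm g p) + sigNeg (quadForm g p)) : ConstSignatureAt g p := by
  filter_upwards [eventually_signature_le hg p, h] with q h1 h2
  omega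

end Signature

/-! ### From constant to arbitrary vector fields -/

section TensorExtension

variable {E : Type*} [NormedAddCommGroup E] [NormedSpace ℝ E] {u : E}

/-- The product rule for the application of a family of linear maps to a vector field. -/
theorem hasFDerivAt_clm_apply_field {N : Type*} [NormedAddCommGroup N] [NormedSpace ℝ N]
    {B : E → E →L[ℝ] N} {X : E → E} (L : N →L[ℝ] ℝ) (hB : DifferentiableAt ℝ B u)
    (hX : DifferentiableAt ℝ X u) :
    HasFDerivAt (fun u' => L (B u' (X u')))
      (fderiv ℝ (fun u' => L (B u' (X u))) u + L.comp ((B u).comp (fderiv ℝ X u))) u := by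
  have h1 := L.hasFDerivAt.comp u (hB.hasFDerivAt.clm_apply hX.hasFDerivAt)
  have h2 : HasFDerivAt (fun u' => L (B u' (X u))) _ u :=
    L.hasFDerivAt.comp u (hB.hasFDerivAt.clm_apply (hasFDerivAt_const (X u) u))
  refine h1.congr_fderiv ?_
  rw [h2.fderiv]
  ext z
  simp
  ring

variable {G : E → E →L[ℝ] E →L[ℝ] ℝ}

theorem hasFDerivAt_fderiv_fields (hG : ContDiffAt ℝ ∞ G u) {X Y W : E → E}
    (hX : DifferentiableAt ℝ X u) (hY : DifferentiableAt ℝ Y u) (hW : DifferentiableAt ℝ W u) :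
    DifferentiableAt ℝ (fun u' => fderiv ℝ G u' (X u') (Y u') (W u')) u ∧ ∀ z,
    fderiv ℝ (fun u' => fderiv ℝ G u' (X u') (Y u') (W u')) u z =
      fderiv ℝ (fun u' => fderiv ℝ G u' (X u) (Y u) (W u)) u z +
        fderiv ℝ G u (fderiv ℝ X u z) (Y u) (W u) + fderiv ℝ G u (X u) (fderiv ℝ Y u z) (W u) +
        fderiv ℝ G u (X u) (Y u) (fderiv ℝ W u z) := by
  have hD := (contDiffAt_fderiv_apply hG).differentiableAt (by simp)
  have hDX := hD.clm_apply hX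
  have hDXY := hDX.clm_apply hY
  -- The slots are frozen one after the other: `W` here, then `Y`, then `X`.
  have h3 := hasFDerivAt_clm_apply_field (ContinuousLinearMap.id ℝ ℝ) hDXY hW
  have h2 := hasFDerivAt_clm_apply_field (ContinuousLinearMap.apply ℝ ℝ (W u)) hDX hY
  have h1 := hasFDerivAt_clm_apply_field ((ContinuousLinearMap.apply ℝ ℝ (W u)).comp
    (ContinuousLinearMap.apply ℝ (E →L[ℝ] ℝ) (Y u))) hD hX
  refine ⟨h3.differentiableAt, fun z => ?_⟩
  have e3 := congrArg (fun L => L z) h3.fderiv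
  have e2 := congrArg (fun L => L z) h2.fderiv
  have e1 := congrArg (fun L => L z) h1.fderiv
  simp only [ContinuousLinearMap.apply_apply, ContinuousLinearMap.id_apply, add_apply,
    ContinuousLinearMap.comp_apply] at e1 e2 e3
  rw [e3, e2, e1]

theorem fderiv_christoffel_fields (hG : ContDiffAt ℝ ∞ G u) {X Y W : E → E}
    (hX : DifferentiableAt ℝ X u) (hY : DifferentiableAt ℝ Y u) (hW : DifferentiableAt ℝ W u)
    (z : E) :
    fderiv ℝ (fun u' => christoffel G u' (X u') (Y u') (W u')) u z =
      fderiv ℝ (fun u' => christoffel G u' (X u) (Y u) (W u)) u z +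
        christoffel G u (fderiv ℝ X u z) (Y u) (W u) +
        christoffel G u (X u) (fderiv ℝ Y u z) (W u) +
        christoffel G u (X u) (Y u) (fderiv ℝ W u z) := by
  have key : ∀ X Y W : E → E, DifferentiableAt ℝ X u → DifferentiableAt ℝ Y u →
      DifferentiableAt ℝ W u →
      fderiv ℝ (fun u' => christoffel G u' (X u') (Y u') (W u')) u z = (1 / 2 : ℝ) *
        (fderiv ℝ (fun u' => fderiv ℝ G u' (X u') (Y u') (W u')) u z +
        fderiv ℝ (fun u' => fderiv ℝ G u' (Y u') (W u') (X u')) u z -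
        fderiv ℝ (fun u' => fderiv ℝ G u' (W u') (X u') (Y u')) u z) := by
    intro X Y W hX hY hW
    have h := (((hasFDerivAt_fderiv_fields hG hX hY hW).1.hasFDerivAt.add
      (hasFDerivAt_fderiv_fields hG hY hW hX).1.hasFDerivAt).sub
      (hasFDerivAt_fderiv_fields hG hW hX hY).1.hasFDerivAt).const_mul (1 / 2 : ℝ)
    exact congrArg (fun L => L z) h.fderiv
  rw [key X Y W hX hY hW, key (fun _ => X u) (fun _ => Y u) (fun _ => W u)
    (differentiableAt_const _) (differentiableAt_const _) (differentiableAt_const _),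
    (hasFDerivAt_fderiv_fields hG hX hY hW).2, (hasFDerivAt_fderiv_fields hG hY hW hX).2,
    (hasFDerivAt_fderiv_fields hG hW hX hY).2]
  simp only [christoffel]
  ring

theorem isLinearMap_eq_sum [FiniteDimensional ℝ E] {L : E → ℝ} (hL : IsLinearMap ℝ L) (v : E) :
    L v = ∑ i, (Module.finBasis ℝ E).repr v i * L (Module.finBasis ℝ E i) := by
  have h : L v = hL.mk' _ (∑ i, (Module.finBasis ℝ E).repr v i • Module.finBasis ℝ E i) := by
    rw [(Module.finBasis ℝ E).sum_repr]; rfl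
  rw [h, map_sum]
  simp

/-- The smooth extensions for constant vector fields combine to smooth extensions for arbitrary
vector fields. -/
theorem ChartSemiRegular.exists_extension_fields [FiniteDimensional ℝ E] {U S : Set E}
    (h : ChartSemiRegular G U S) {X Y Z : E → E} (hX : ∀ u ∈ U, ContDiffAt ℝ ∞ X u)
    (hY : ∀ u ∈ U, ContDiffAt ℝ ∞ Y u) (hZ : ∀ u ∈ U, ContDiffAt ℝ ∞ Z u) :
    ∃ R : E → E → ℝ, (∀ u ∈ U, ∀ w, ContDiffAt ℝ ∞ (fun u' => R u' w) u) ∧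
      (∀ u ∈ U, ∃ v, ∀ w, R u w = G u v w) ∧
      ∀ u ∈ U, u ∈ S → ∀ w a b, (∀ w', christoffel G u (Z u) w w' = G u a w') →
        (∀ w', christoffel G u (X u) (Y u) w' = G u b w') →
        R u w = fderiv ℝ (fun u' => christoffel G u' (X u) (Y u) w) u (Z u) - G u a b := by
  let e := Module.finBasis ℝ E
  choose r hr1 hr2 hr3 using h.exists_extension
  have hcoef : ∀ {V : E → E} {u : E}, ContDiffAt ℝ ∞ V u → ∀ i,
      ContDiffAt ℝ ∞ (fun u' => e.repr (V u') i) u := fun hV i =>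
    (e.coord i).toContinuousLinearMap.contDiff.contDiffAt.comp _ hV
  refine ⟨fun u w => ∑ i, e.repr (Z u) i * ∑ j, e.repr (X u) j * ∑ k, e.repr (Y u) k *
    r (e j) (e k) (e i) u w, ?_, ?_, ?_⟩
  · intro u hu w
    exact ContDiffAt.sum fun i _ => (hcoef (hZ u hu) i).mul (ContDiffAt.sum fun j _ =>
      (hcoef (hX u hu) j).mul (ContDiffAt.sum fun k _ =>
        (hcoef (hY u hu) k).mul (hr1 _ _ _ u hu w)))
  · intro u hu
    choose v hv using fun i j k => hr2 (e j) (e k) (e i) u hu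
    refine ⟨∑ i, e.repr (Z u) i • ∑ j, e.repr (X u) j • ∑ k, e.repr (Y u) k • v i j k,
      fun w => ?_⟩
    simp only [map_sum, map_smul, sum_apply, smul_apply, smul_eq_mul, hv]
  · intro u hu huS w a b ha hb
    choose A hA using fun z => h.christoffel_mem u hu z w
    choose B hB using fun x y => h.christoffel_mem u hu x y
    have hs := h.symm u hu
    let T : E → E → E → ℝ := fun z x y =>
      fderiv ℝ (fun u' => christoffel G u' x y w) u z - G u (A z) (B x y)
    have hd : ∀ x y, DifferentiableAt ℝ (fun u' => christoffel G u' x y w) u := fun x y =>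
      (contDiffAt_christoffel (h.smooth u hu) contDiffAt_const contDiffAt_const
        contDiffAt_const).differentiableAt (by simp)
    -- The chosen vectors `A z` and `B x y` need not depend linearly on their arguments. Their
    -- pairing does, since it can be read as a Christoffel symbol in either way; so `T` is trilinear
    -- and determined by basis vectors.
    have hAB : ∀ z x y, G u (A z) (B x y) = christoffel G u x y (A z) := fun z x y => by
      rw [hs, hB]
    have hT1 : ∀ x y, IsLinearMap ℝ fun z => T z x y := fun x y => by
      constructor
      · intro z z'
        simp only [T, ← hA, christoffel_add_left, map_add]; ring
      · intro c z
        simp only [T, ← hA, christoffel_smul_left, map_smul, smul_eq_mul]; ring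
    have hT2 : ∀ z y, IsLinearMap ℝ fun x => T z x y := fun z y => by
      constructor
      · intro x x'
        simp only [T, hAB, christoffel_add_left]
        rw [fderiv_fun_add (hd x y) (hd x' y), add_apply]; ring
      · intro c x
        simp only [T, hAB, christoffel_smul_left]
        rw [fderiv_const_mul (hd x y), smul_apply, smul_eq_mul, smul_eq_mul]; ring
    have hT3 : ∀ z x, IsLinearMap ℝ fun y => T z x y := fun z x => by
      constructor
      · intro y y'
        simp only [T, hAB, christoffel_add_middle]
        rw [fderiv_fun_add (hd x y) (hd x y'), add_apply]; ring
      · intro c y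
        simp only [T, hAB, christoffel_smul_middle]
        rw [fderiv_const_mul (hd x y), smul_apply, smul_eq_mul, smul_eq_mul]; ring
    have hab : G u a b = G u (A (Z u)) (B (X u) (Y u)) := by
      rw [← ha, hA, hs, ← hb, hB, hs]
    rw [hab]
    change _ = T (Z u) (X u) (Y u)
    rw [isLinearMap_eq_sum (hT1 _ _)]
    refine Finset.sum_congr rfl fun i _ => congrArg _ ?_
    rw [isLinearMap_eq_sum (hT2 _ _)]
    refine Finset.sum_congr rfl fun j _ => congrArg _ ?_
    rw [isLinearMap_eq_sum (hT3 _ _)]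
    refine Finset.sum_congr rfl fun k _ => congrArg _ ?_
    exact hr3 _ _ _ u hu huS w _ _ (hA _) (hB _ _)

end TensorExtension

section ChartCovDeriv

variable {E : Type*} [NormedAddCommGroup E] [NormedSpace ℝ E] [FiniteDimensional ℝ E]
  {G : E → E →L[ℝ] E →L[ℝ] ℝ}

/-- The coordinate expression of the extension of `∇_Z ∇^♭_X Y`. -/
theorem ChartSemiRegular.exists_covDeriv {U S : Set E} (hU : IsOpen U)
    (h : ChartSemiRegular G U S) {X Y Z : E → E} (hX : ∀ u ∈ U, ContDiffAt ℝ ∞ X u)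
    (hY : ∀ u ∈ U, ContDiffAt ℝ ∞ Y u) (hZ : ∀ u ∈ U, ContDiffAt ℝ ∞ Z u) :
    ∃ t : E → E → ℝ, (∀ u ∈ U, ∀ w, ContDiffAt ℝ ∞ (fun u' => t u' w) u) ∧
      (∀ u ∈ U, ∃ v, ∀ w, t u w = G u v w) ∧
      ∀ u ∈ U, u ∈ S → ∀ W : E → E, ContDiffAt ℝ ∞ W u → ∀ a b,
        (∀ w', christoffel G u (Z u) (W u) w' = G u a w') →
        (∀ w', christoffel G u (X u) (Y u) w' = G u b w') →
        t u (W u) = fderiv ℝ (fun u' => G u' (fderiv ℝ Y u' (X u')) (W u') +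
            christoffel G u' (X u') (Y u') (W u')) u (Z u) -
          G u (fderiv ℝ W u (Z u) + a) (fderiv ℝ Y u (X u) + b) := by
  obtain ⟨R, hR1, hR2, hR3⟩ := h.exists_extension_fields hX hY hZ
  let D : E → E := fun u => fderiv ℝ Y u (X u)
  have hD : ∀ u ∈ U, ContDiffAt ℝ ∞ D u := fun u hu =>
    (contDiffAt_fderiv_apply (hY u hu)).clm_apply (hX u hu)
  -- These are the terms of `∇_Z (G(D, ·) + Γ(X, Y, ·))`: the first two come from `G(D, ·)`, the
  -- next two from differentiating the arguments `X` and `Y` of `Γ`, and `R` is the tensorial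
  -- remainder.
  refine ⟨fun u w => G u (fderiv ℝ D u (Z u)) w + christoffel G u (Z u) (D u) w +
    christoffel G u (fderiv ℝ X u (Z u)) (Y u) w +
    christoffel G u (X u) (fderiv ℝ Y u (Z u)) w + R u w, ?_, ?_, ?_⟩
  · intro u hu w
    have hG := h.smooth u hu
    exact (((((hG.clm_apply ((contDiffAt_fderiv_apply (hD u hu)).clm_apply (hZ u hu))).clm_apply
      contDiffAt_const).add (contDiffAt_christoffel hG (hZ u hu) (hD u hu) contDiffAt_const)).add
      (contDiffAt_christoffel hG ((contDiffAt_fderiv_apply (hX u hu)).clm_apply (hZ u hu))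
        (hY u hu) contDiffAt_const)).add
      (contDiffAt_christoffel hG (hX u hu)
        ((contDiffAt_fderiv_apply (hY u hu)).clm_apply (hZ u hu)) contDiffAt_const)).add
      (hR1 u hu w)
  · intro u hu
    obtain ⟨v1, h1⟩ := h.christoffel_mem u hu (Z u) (D u)
    obtain ⟨v2, h2⟩ := h.christoffel_mem u hu (fderiv ℝ X u (Z u)) (Y u)
    obtain ⟨v3, h3⟩ := h.christoffel_mem u hu (X u) (fderiv ℝ Y u (Z u))
    obtain ⟨v4, h4⟩ := hR2 u hu
    refine ⟨fderiv ℝ D u (Z u) + v1 + v2 + v3 + v4, fun w => ?_⟩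
    simp only [map_add, add_apply, h1, h2, h3, h4]
  · intro u hu huS W hW a b ha hb
    have hG := h.smooth u hu
    have hGd : DifferentiableAt ℝ G u := hG.differentiableAt (by simp)
    have hWd : DifferentiableAt ℝ W u := hW.differentiableAt (by simp)
    have hDd : DifferentiableAt ℝ D u := (hD u hu).differentiableAt (by simp)
    have hs : ∀ᶠ u' in 𝓝 u, ∀ x y, G u' x y = G u' y x := by
      filter_upwards [hU.mem_nhds hu] with u' hu' using h.symm u' hu'
    have e1 := fderiv_pairing hGd hDd hWd (Z u)
    have e2 := fderiv_christoffel_fields hG ((hX u hu).differentiableAt (by simp))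
      ((hY u hu).differentiableAt (by simp)) hWd (Z u)
    have e3 : fderiv ℝ (fun u' => G u' (D u') (W u') + christoffel G u' (X u') (Y u') (W u')) u
        (Z u) = fderiv ℝ (fun u' => G u' (D u') (W u')) u (Z u) +
          fderiv ℝ (fun u' => christoffel G u' (X u') (Y u') (W u')) u (Z u) := by
      rw [fderiv_fun_add ((hGd.clm_apply hDd).clm_apply hWd)
        ((contDiffAt_christoffel hG (hX u hu) (hY u hu) hW).differentiableAt (by simp)), add_apply]
    -- By metric compatibility the derivative of `G` yields `Γ(Z, D, W) + Γ(Z, W, D)`; the second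
    -- summand cancels `G(a, D)` through `e6`. Through `e7` the term `Γ(X, Y, ∂_Z W)` cancels `G(∂_Z
    -- W, b)`.
    have e4 := christoffel_add_christoffel hGd hs (Z u) (D u) (W u)
    have e5 := hR3 u hu huS (W u) a b ha hb
    have e6 := ha (D u)
    have e7 := hb (fderiv ℝ W u (Z u))
    have s1 := h.symm u hu (fderiv ℝ W u (Z u)) b
    have s2 := h.symm u hu (fderiv ℝ W u (Z u)) (D u)
    change _ = fderiv ℝ (fun u' => G u' (D u') (W u') + christoffel G u' (X u') (Y u') (W u')) u
        (Z u) - G u (fderiv ℝ W u (Z u) + a) (D u + b)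
    rw [e3, e1, e2]
    simp only [map_add, add_apply]
    linarith

end ChartCovDeriv

/-! ### From charts back to the manifold: gluing the local extensions -/

section Backward

variable {E : Type*} [NormedAddCommGroup E] [NormedSpace ℝ E] [FiniteDimensional ℝ E]
  {H : Type*} [TopologicalSpace H] {I : ModelWithCorners ℝ E H} [I.Boundaryless]
  {M : Type*} [TopologicalSpace M] [ChartedSpace H M] [IsManifold I ∞ M] {g : FormField I M}

theorem lowerCovDeriv_eq_of_christoffel (hg : IsSingularMetric g) {p₀ : M} {u : E}
    {X Y : ∀ p : M, TangentSpace I p} (hu : u ∈ (extChartAt I p₀).target)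
    (hX : IsSmoothVectorField X) (hY : IsSmoothVectorField Y) {a : E}
    (ha : ∀ w, christoffel (chartForm g p₀) u (chartField p₀ X u) (chartField p₀ Y u) w =
      chartForm g p₀ u a w) :
    lowerCovDeriv g X Y ((extChartAt I p₀).symm u) = g _ (chartFrame I p₀ u
      (fderiv ℝ (chartField p₀ Y) u (chartField p₀ X u) + a)) := by
  ext v
  obtain ⟨w, rfl⟩ := chartFrame_surjective hu v
  rw [lowerCovDeriv_symm hg hu hX hY, ha, ← chartForm_apply, map_add, add_apply]

/-- A metric which is semi-regular in charts is radical-stationary. -/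
theorem isRadicalStationary_of_chart (hg : IsSingularMetric g)
    (h : ∀ p₀ : M, ∃ U : Set E, IsOpen U ∧ extChartAt I p₀ p₀ ∈ U ∧
      U ⊆ (extChartAt I p₀).target ∧ ChartSemiRegular (chartForm g p₀) U
        {u | ConstSignatureAt g ((extChartAt I p₀).symm u)}) :
    IsRadicalStationary g := by
  have : CompleteSpace E := FiniteDimensional.complete ℝ E
  intro X Y hX hY
  constructor
  · refine isSmoothOneForm_of_chart fun p₀ w => ?_
    have hu := mem_extChartAt_target (I := I) p₀
    have hXs := contDiffAt_chartField hu (hX _)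
    have hYs := contDiffAt_chartField hu (hY _)
    have hG := contDiffAt_chartForm hg hu
    refine (((hG.clm_apply ((contDiffAt_fderiv_apply hYs).clm_apply hXs)).clm_apply
      (contDiffAt_const (c := w))).add
      (contDiffAt_christoffel hG hXs hYs (contDiffAt_const (c := w)))).congr_of_eventuallyEq ?_
    filter_upwards [(isOpen_extChartAt_target p₀).mem_nhds hu] with u' hu'
    rw [lowerCovDeriv_symm hg hu' hX hY]
  · intro p₀
    obtain ⟨U, hU, hpU, hUt, hs⟩ := h p₀
    obtain ⟨a, ha⟩ := hs.christoffel_mem _ hpU (chartField p₀ X (extChartAt I p₀ p₀))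
      (chartField p₀ Y (extChartAt I p₀ p₀))
    have e := lowerCovDeriv_eq_of_christoffel hg (hUt hpU) hX hY ha
    rw [← extChartAt_to_inv (I := I) p₀]
    exact ⟨_, e.symm⟩

/-- The local extension of `∇_Z ∇^♭_X Y`. -/
theorem exists_local_covDeriv (hg : IsSingularMetric g) {p₀ : M} {U : Set E} (hU : IsOpen U)
    (hpU : extChartAt I p₀ p₀ ∈ U) (hUt : U ⊆ (extChartAt I p₀).target)
    (hs : ChartSemiRegular (chartForm g p₀) U
      {u | ConstSignatureAt g ((extChartAt I p₀).symm u)})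
    {X Y Z : ∀ p : M, TangentSpace I p} (hX : IsSmoothVectorField X)
    (hY : IsSmoothVectorField Y) (hZ : IsSmoothVectorField Z)
    (hη : IsSmoothOneForm (lowerCovDeriv g X Y)) :
    ∃ (V : Set M) (θ : CovectorField I M), IsOpen V ∧ p₀ ∈ V ∧
      (∀ p ∈ V, θ p ∈ radicalAnnihilator g p) ∧
      (∀ w, ContDiffAt ℝ ∞ (fun u => θ ((extChartAt I p₀).symm u) (chartFrame I p₀ u w))
        (extChartAt I p₀ p₀)) ∧
      (∀ W : ∀ p : M, TangentSpace I p, IsSmoothVectorField W → ∀ p ∈ V,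
        ContinuousAt (fun q => θ q (W q)) p) ∧
      ∀ W : ∀ p : M, TangentSpace I p, IsSmoothVectorField W → ∀ p ∈ V,
        ConstSignatureAt g p → θ p (W p) = covDeriv g Z (lowerCovDeriv g X Y) W p := by
  have : CompleteSpace E := FiniteDimensional.complete ℝ E
  have hfield : ∀ {X : ∀ p : M, TangentSpace I p}, IsSmoothVectorField X →
      ∀ u ∈ U, ContDiffAt ℝ ∞ (chartField p₀ X) u := fun hX u hu =>
    contDiffAt_chartField (hUt hu) (hX _)
  obtain ⟨t, ht1, ht2, ht3⟩ := hs.exists_covDeriv hU (hfield hX) (hfield hY) (hfield hZ)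
  choose! v hv using ht2
  let φ := extChartAt I p₀
  -- This form lies in the range of `g` by construction. The choice of `v` need not be continuous;
  -- regularity of `θ` comes from that of `t`.
  let θ : CovectorField I M := fun p => g p (coordField I p₀ (v (φ p)) p)
  have hθ : ∀ u ∈ U, ∀ w, θ (φ.symm u) (chartFrame I p₀ u w) = t u w := by
    intro u hu w
    simp only [θ, φ]
    rw [(extChartAt I p₀).right_inv (hUt hu), coordField_symm (hUt hu), hv u hu w, chartForm_apply]
  have hθW : ∀ u ∈ U, ∀ W : ∀ p : M, TangentSpace I p,
      θ (φ.symm u) (W (φ.symm u)) = t u (chartField p₀ W u) := by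
    intro u hu W
    rw [← hθ u hu, chartFrame_chartField (hUt hu)]
  let V : Set M := φ.source ∩ φ ⁻¹' U
  have hV : IsOpen V := (continuousOn_extChartAt p₀).isOpen_inter_preimage
    (isOpen_extChartAt_source p₀) hU
  have hVs : ∀ p ∈ V, φ.symm (φ p) = p := fun p hp => φ.left_inv hp.1
  refine ⟨V, θ, hV, ⟨mem_extChartAt_source p₀, hpU⟩, fun p _ => ⟨_, rfl⟩, ?_, ?_, ?_⟩
  · intro w
    refine (ht1 _ hpU w).congr_of_eventuallyEq ?_
    filter_upwards [hU.mem_nhds hpU] with u hu using hθ u hu w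
  · intro W hW p hp
    let e := Module.finBasis ℝ E
    -- Smoothness of `t` is known only for a fixed second argument, so the varying field `W` is
    -- expanded in a basis.
    have h1 : ContinuousAt (fun u => ∑ i, e.repr (chartField p₀ W u) i * t u (e i)) (φ p) := by
      have h2 : ContDiffAt ℝ ∞ (fun u => ∑ i, e.repr (chartField p₀ W u) i * t u (e i)) (φ p) :=
        ContDiffAt.sum fun i _ => ((e.coord i).toContinuousLinearMap.contDiff.contDiffAt.comp _
          (hfield hW _ hp.2)).mul (ht1 _ hp.2 _)
      exact h2.continuousAt
    refine (ContinuousAt.comp (g := fun u => ∑ i, e.repr (chartField p₀ W u) i * t u (e i)) h1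
      (continuousAt_extChartAt' hp.1)).congr ?_
    filter_upwards [hV.mem_nhds hp] with q hq
    have h3 := hθW (φ q) hq.2 W
    rw [hVs q hq] at h3
    rw [h3]
    have hlin : IsLinearMap ℝ fun w => t (φ q) w := by
      constructor
      · intro x y; simp only [hv _ hq.2, map_add]
      · intro c x; simp only [hv _ hq.2, map_smul]
    exact (isLinearMap_eq_sum hlin _).symm
  · intro W hW p hp hc
    have key : ∀ u ∈ U, ConstSignatureAt g (φ.symm u) → θ (φ.symm u) (W (φ.symm u)) =
        covDeriv g Z (lowerCovDeriv g X Y) W (φ.symm u) := by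
      intro u hu hc
      obtain ⟨a, ha⟩ := hs.christoffel_mem u hu (chartField p₀ Z u) (chartField p₀ W u)
      obtain ⟨b, hb⟩ := hs.christoffel_mem u hu (chartField p₀ X u) (chartField p₀ Y u)
      rw [hθW u hu, ht3 u hu hc _ (hfield hW u hu) a b ha hb, covDeriv,
        dirDeriv_symm (hUt hu) _
          ((contMDiffAt_oneForm_apply hη (hW _)).mdifferentiableAt (by simp)),
        lowerCovDeriv_eq_of_christoffel hg (hUt hu) hZ hW ha,
        lowerCovDeriv_eq_of_christoffel hg (hUt hu) hX hY hb, coInner_flat _ _ (hg.symm _),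
        ← chartForm_apply]
      congr 2
      apply Filter.EventuallyEq.fderiv_eq
      filter_upwards [hU.mem_nhds hu] with u' hu'
      rw [← lowerCovDeriv_symm hg (hUt hu') hX hY, chartFrame_chartField (hUt hu')]
    have h := key (φ p) hp.2
    rw [hVs p hp] at h
    exact h hc

/-- A metric which is semi-regular in charts is semi-regular. -/
theorem isSemiRegular_of_chart [T2Space M] (hg : IsSingularMetric g)
    (h : ∀ p₀ : M, ∃ U : Set E, IsOpen U ∧ extChartAt I p₀ p₀ ∈ U ∧
      U ⊆ (extChartAt I p₀).target ∧ ChartSemiRegular (chartForm g p₀) U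
        {u | ConstSignatureAt g ((extChartAt I p₀).symm u)}) :
    IsSemiRegular g := by
  have hrs := isRadicalStationary_of_chart hg h
  refine ⟨hg, hrs, fun X Y Z hX hY hZ => ?_⟩
  choose U hU hpU hUt hs using h
  have hloc := fun p₀ : M => exists_local_covDeriv hg (hU p₀) (hpU p₀) (hUt p₀) (hs p₀) hX hY hZ
    (hrs X Y hX hY).1
  choose V θ hV hpV hmem hsm hcont hcov using hloc
  -- Paired with any smooth `W`, both local extensions are continuous and equal the covariant
  -- derivative on the dense set of points of locally constant signature. The diagonal `θ p p` is
  -- therefore locally given by a single `θ q`.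
  have hagree : ∀ q, ∀ p ∈ V q, θ q p = θ p p := by
    intro q p hp
    ext v
    obtain ⟨W, hW, rfl⟩ := exists_smoothVectorField_eq p v
    have hne : (𝓝[{p | ConstSignatureAt g p}] p).NeBot :=
      mem_closure_iff_nhdsWithin_neBot.1 (dense_constSignatureAt hg p)
    refine tendsto_nhds_unique (l := 𝓝[{p | ConstSignatureAt g p}] p)
      ((hcont q W hW p hp).tendsto.mono_left nhdsWithin_le_nhds)
      (((hcont p W hW p (hpV p)).tendsto.mono_left nhdsWithin_le_nhds).congr' ?_)
    filter_upwards [self_mem_nhdsWithin, nhdsWithin_le_nhds ((hV q).mem_nhds hp),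
      nhdsWithin_le_nhds ((hV p).mem_nhds (hpV p))] with p' h1 h2 h3
    rw [hcov p W hW p' h3 h1, hcov q W hW p' h2 h1]
  refine ⟨fun p => θ p p, ⟨isSmoothOneForm_of_chart fun p₀ w => ?_, fun p => hmem p p (hpV p)⟩,
    fun W hW p hc => hcov p W hW p (hpV p) hc⟩
  refine (hsm p₀ w).congr_of_eventuallyEq ?_
  have hc : Filter.Tendsto (extChartAt I p₀).symm (𝓝 (extChartAt I p₀ p₀)) (𝓝 p₀) := by
    have := (continuousAt_extChartAt_symm (I := I) p₀).tendsto
    rwa [extChartAt_to_inv] at this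
  filter_upwards [hc.eventually ((hV p₀).mem_nhds (hpV p₀))] with u hu
  rw [hagree p₀ _ hu]

end Backward

/-! ### Charts of the product manifold and the warped metric in them -/

section Product

variable {EB : Type*} [NormedAddCommGroup EB] [NormedSpace ℝ EB]
  {HB : Type*} [TopologicalSpace HB] {IB : ModelWithCorners ℝ EB HB}
  {B : Type*} [TopologicalSpace B] [ChartedSpace HB B]
  {l : ℕ} {EF : Fin l → Type*} [∀ j, NormedAddCommGroup (EF j)] [∀ j, NormedSpace ℝ (EF j)]
  {HF : Fin l → Type*} [∀ j, TopologicalSpace (HF j)]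
  {IF : ∀ j, ModelWithCorners ℝ (EF j) (HF j)}
  {F : Fin l → Type*} [∀ j, TopologicalSpace (F j)] [∀ j, ChartedSpace (HF j) (F j)]

instance boundaryless_pi [∀ j, (IF j).Boundaryless] : (ModelWithCorners.pi IF).Boundaryless := by
  constructor
  rw [Set.eq_univ_iff_forall]
  intro u
  choose y hy using fun j => ((IF j).range_eq_univ ▸ Set.mem_univ (u j) : u j ∈ Set.range (IF j))
  exact ⟨y, funext hy⟩

theorem hasMFDerivAt_base (p : B × ∀ j, F j) :
    HasMFDerivAt (IB.prod (ModelWithCorners.pi IF)) IB (Prod.fst : B × (∀ j, F j) → B) p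
      (ContinuousLinearMap.fst ℝ EB (∀ j, EF j)) :=
  hasMFDerivAt_fst p

variable [∀ j, (IF j).Boundaryless]

theorem mem_extChartAt_warped_target {p : B × ∀ j, F j} {u : EB × ∀ j, EF j} :
    u ∈ (extChartAt (IB.prod (ModelWithCorners.pi IF)) p).target ↔
      u ∈ productDomain (extChartAt IB p.1).target
        (fun j => (extChartAt (IF j) (p.2 j)).target) := by
  have hpi : ∀ (x : ∀ j, F j) (v : ∀ j, EF j), v ∈ (extChartAt (ModelWithCorners.pi IF) x).target ↔
      ∀ j, v j ∈ (extChartAt (IF j) (x j)).target := by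
    intro x v
    simp only [extChartAt_target, ModelWithCorners.range_eq_univ, Set.inter_univ]
    exact Set.mem_univ_pi
  rw [extChartAt_prod]
  exact and_congr Iff.rfl (hpi _ _)

variable [IB.Boundaryless]

theorem hasMFDerivAt_fiber (p : B × ∀ j, F j) (j : Fin l) :
    HasMFDerivAt (IB.prod (ModelWithCorners.pi IF)) (IF j) (fun q : B × ∀ j, F j => q.2 j) p
      (fiberProj EB EF j) := by
  refine ⟨by fun_prop, ?_⟩
  refine ((fiberProj EB EF j).hasFDerivAt.congr_of_eventuallyEq ?_).hasFDerivWithinAt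
  filter_upwards [(isOpen_extChartAt_target (I := IB.prod (ModelWithCorners.pi IF)) p).mem_nhds
    (mem_extChartAt_target p)] with u hu
  exact (extChartAt (IF j) (p.2 j)).right_inv ((mem_extChartAt_warped_target.1 hu).2 j)

theorem multiplyWarpedMetric_apply (gB : FormField IB B) (gF : ∀ j, FormField (IF j) (F j))
    (f : Fin l → B → ℝ) (p : B × ∀ j, F j)
    (v w : TangentSpace (IB.prod (ModelWithCorners.pi IF)) p) :
    multiplyWarpedMetric gB gF f p v w = gB p.1 v.1 w.1 +
      ∑ j, (f j p.1) ^ 2 * gF j (p.2 j) (v.2 j) (w.2 j) := by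
  have h : multiplyWarpedMetric gB gF f p v w = pullbackForm Prod.fst gB p v w +
      ∑ j, (f j p.1) ^ 2 * pullbackForm (fun q : B × ∀ j, F j => q.2 j) (gF j) p v w := by
    simp only [multiplyWarpedMetric, add_apply, sum_apply, smul_apply, smul_eq_mul]
  simp only [h, pullbackForm_apply, (hasMFDerivAt_base p).mfderiv, (hasMFDerivAt_fiber p _).mfderiv]
  rfl

variable [IsManifold IB ∞ B] [∀ j, IsManifold (IF j) ∞ (F j)]

/-- The projection after the inverse product chart is the inverse base chart after the linear
projection; the chain rule is applied to both sides. -/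
theorem chartFrame_base {p : B × ∀ j, F j} {u : EB × ∀ j, EF j}
    (hu : u ∈ (extChartAt (IB.prod (ModelWithCorners.pi IF)) p).target) (v : EB × ∀ j, EF j) :
    (chartFrame (IB.prod (ModelWithCorners.pi IF)) p u v : EB × ∀ j, EF j).1 =
      chartFrame IB p.1 u.1 v.1 := by
  have h1 := (hasMFDerivAt_base _).comp u
    ((contMDiffAt_extChartAt_symm hu).mdifferentiableAt (by simp)).hasMFDerivAt
  have h2 := ((contMDiffAt_extChartAt_symm (mem_extChartAt_warped_target.1 hu).1).mdifferentiableAt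
    (by simp)).hasMFDerivAt.comp u
    (ContinuousLinearMap.fst ℝ EB (∀ j, EF j)).hasFDerivAt.hasMFDerivAt
  exact congrArg (fun L => L v) (hasMFDerivAt_unique h1 h2)

theorem chartFrame_fiber {p : B × ∀ j, F j} {u : EB × ∀ j, EF j}
    (hu : u ∈ (extChartAt (IB.prod (ModelWithCorners.pi IF)) p).target) (v : EB × ∀ j, EF j)
    (j : Fin l) :
    (chartFrame (IB.prod (ModelWithCorners.pi IF)) p u v : EB × ∀ j, EF j).2 j =
      chartFrame (IF j) (p.2 j) (u.2 j) (v.2 j) := by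
  have h1 := (hasMFDerivAt_fiber _ j).comp u
    ((contMDiffAt_extChartAt_symm hu).mdifferentiableAt (by simp)).hasMFDerivAt
  have h2 := ((contMDiffAt_extChartAt_symm
    ((mem_extChartAt_warped_target.1 hu).2 j)).mdifferentiableAt
    (by simp)).hasMFDerivAt.comp u (fiberProj EB EF j).hasFDerivAt.hasMFDerivAt
  exact congrArg (fun L => L v) (hasMFDerivAt_unique h1 h2)

/-- The coordinate expression of a multiply warped product is a multiply warped product. -/
theorem chartForm_multiplyWarpedMetric (gB : FormField IB B) (gF : ∀ j, FormField (IF j) (F j))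
    (f : Fin l → B → ℝ) {p : B × ∀ j, F j} {u : EB × ∀ j, EF j}
    (hu : u ∈ (extChartAt (IB.prod (ModelWithCorners.pi IF)) p).target) :
    chartForm (multiplyWarpedMetric gB gF f) p u = warpedForm (chartForm gB p.1)
      (fun j => chartForm (gF j) (p.2 j)) (fun j b => f j ((extChartAt IB p.1).symm b)) u := by
  refine ContinuousLinearMap.ext fun v => ContinuousLinearMap.ext fun w => ?_
  rw [chartForm_apply, multiplyWarpedMetric_apply, warpedForm_apply, chartFrame_base hu,
    chartFrame_base hu]
  refine congrArg₂ _ rfl (Finset.sum_congr rfl fun j _ => ?_)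
  rw [chartFrame_fiber hu, chartFrame_fiber hu]
  rfl

theorem isSingularMetric_multiplyWarpedMetric [FiniteDimensional ℝ EB]
    [∀ j, FiniteDimensional ℝ (EF j)] {gB : FormField IB B} {gF : ∀ j, FormField (IF j) (F j)}
    {f : Fin l → B → ℝ} (hgB : IsSingularMetric gB) (hgF : ∀ j, IsSingularMetric (gF j))
    (hf : ∀ j, ContMDiff IB 𝓘(ℝ, ℝ) ∞ (f j)) :
    IsSingularMetric (multiplyWarpedMetric gB gF f) := by
  refine isSingularMetric_of_chart (fun p x y => ?_) fun p => ?_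
  · rw [multiplyWarpedMetric_apply, multiplyWarpedMetric_apply]
    exact congrArg₂ _ (hgB.symm _ _ _)
      (Finset.sum_congr rfl fun j _ => congrArg _ ((hgF j).symm _ _ _))
  · have hu := mem_extChartAt_target (I := IB.prod (ModelWithCorners.pi IF)) p
    have hu' := mem_extChartAt_warped_target.1 hu
    refine (contDiffAt_warpedForm (contDiffAt_chartForm hgB hu'.1)
      (fun j => contDiffAt_chartForm (hgF j) (hu'.2 j))
      (fun j => contDiffAt_comp_symm hu'.1 (hf j _))).congr_of_eventuallyEq ?_
    filter_upwards [(isOpen_extChartAt_target p).mem_nhds hu] with u h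
    exact chartForm_multiplyWarpedMetric gB gF f h

end Product

/-! ### Nullity of a warped metric -/

section Nullity

/-- The nullity of a multiply warped product of bilinear forms with non-degenerate base. -/
theorem finrank_ker_warped {EB : Type*} [NormedAddCommGroup EB] [NormedSpace ℝ EB]
    {l : ℕ} {EF : Fin l → Type*} [∀ j, NormedAddCommGroup (EF j)] [∀ j, NormedSpace ℝ (EF j)]
    [∀ j, FiniteDimensional ℝ (EF j)]
    {T : (EB × ∀ j, EF j) →L[ℝ] (EB × ∀ j, EF j) →L[ℝ] ℝ} {A : EB →L[ℝ] EB →L[ℝ] ℝ}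
    {C : ∀ j, EF j →L[ℝ] EF j →L[ℝ] ℝ} {c : Fin l → ℝ}
    (hT : ∀ v w, T v w = A v.1 w.1 + ∑ j, c j * C j (v.2 j) (w.2 j))
    (hA : ∀ x, (∀ y, A x y = 0) → x = 0) :
    Module.finrank ℝ (LinearMap.ker T.toLinearMap) =
      ∑ j, Module.finrank ℝ (LinearMap.ker (c j • C j).toLinearMap) := by
  have hK : ∀ j (x : EF j), x ∈ LinearMap.ker (c j • C j).toLinearMap ↔
      ∀ y : EF j, c j * C j x y = 0 := fun j x => by
    rw [LinearMap.mem_ker]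
    exact ContinuousLinearMap.ext_iff
  have hL : ∀ v, v ∈ LinearMap.ker T.toLinearMap ↔
      v.1 = 0 ∧ ∀ j, v.2 j ∈ LinearMap.ker (c j • C j).toLinearMap := by
    intro v
    have h0 : v ∈ LinearMap.ker T.toLinearMap ↔ ∀ w, T v w = 0 := by
      rw [LinearMap.mem_ker]
      exact ContinuousLinearMap.ext_iff
    rw [h0]
    constructor
    · refine fun h => ⟨hA v.1 fun y => ?_, fun j => (hK j _).2 fun y => ?_⟩
      · simpa [hT] using h (y, 0)
      · have h1 := h (0, Pi.single j y)
        rw [hT, Finset.sum_eq_single j (fun i _ hij => by simp [Pi.single_eq_of_ne hij])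
          (by simp)] at h1
        simpa only [Pi.single_eq_same, map_zero, zero_add] using h1
    · rintro ⟨h1, h2⟩ w
      rw [hT, h1, Finset.sum_eq_zero fun j _ => (hK j _).1 (h2 j) _]
      simp
  let e : LinearMap.ker T.toLinearMap ≃ₗ[ℝ] ∀ j, LinearMap.ker (c j • C j).toLinearMap :=
    { toFun := fun v j => ⟨(v : EB × ∀ j, EF j).2 j, ((hL v).1 v.2).2 j⟩
      invFun := fun w => ⟨(0, fun j => w j), (hL _).2 ⟨rfl, fun j => (w j).2⟩⟩
      map_add' := fun _ _ => rfl
      map_smul' := fun _ _ => rfl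
      left_inv := fun v => Subtype.ext (Prod.ext ((hL v).1 v.2).1.symm rfl)
      right_inv := fun _ => rfl }
  exact e.finrank_eq.trans (Module.finrank_pi_fintype ℝ)

variable {E : Type*} [NormedAddCommGroup E] [NormedSpace ℝ E]
  {H : Type*} [TopologicalSpace H] {I : ModelWithCorners ℝ E H}
  {M : Type*} [TopologicalSpace M] [ChartedSpace H M]

/-- The nullity of the bilinear form `c • g p`. -/
noncomputable def nullity (g : FormField I M) (c : ℝ) (p : M) : ℕ :=
  Module.finrank ℝ (LinearMap.ker (c • g p).toLinearMap)

theorem nullity_zero (g : FormField I M) (p : M) : nullity g 0 p = Module.finrank ℝ E := by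
  have h : LinearMap.ker ((0 : ℝ) • g p).toLinearMap = ⊤ := by ext x; simp
  rw [nullity, h, finrank_top]
  rfl

theorem ker_smul_eq (g : FormField I M) {c : ℝ} (hc : c ≠ 0) (p : M) :
    LinearMap.ker (c • g p).toLinearMap = LinearMap.ker (g p).toLinearMap := by
  ext x; simp [hc]

theorem nullity_le_finrank [FiniteDimensional ℝ E] (g : FormField I M) (c : ℝ) (p : M) :
    nullity g c p ≤ Module.finrank ℝ E :=
  Submodule.finrank_le (R := ℝ) (M := E) _

theorem eq_zero_of_nullity_eq [FiniteDimensional ℝ E] {g : FormField I M} {c : ℝ} (hc : c ≠ 0)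
    {p : M} (h : nullity g c p = Module.finrank ℝ E) : g p = 0 := by
  rw [nullity, ker_smul_eq g hc] at h
  have h2 := Submodule.eq_top_of_finrank_eq (K := ℝ) (V := E) h
  refine ContinuousLinearMap.ext fun v => ?_
  have h3 : v ∈ LinearMap.ker (g p).toLinearMap := by rw [h2]; trivial
  exact h3

theorem signature_add_nullity [IsManifold I ∞ M] [FiniteDimensional ℝ E] {g : FormField I M}
    (hg : IsSingularMetric g) {c : ℝ} (hc : c ≠ 0) (p : M) :
    sigPos (quadForm g p) + sigNeg (quadForm g p) + nullity g c p = Module.finrank ℝ E := by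
  rw [nullity, ker_smul_eq g hc, signature_add_finrank_ker hg]

end Nullity

/-! ### Where the signature of a warped product is locally constant -/

section WarpedSignature

variable {EB : Type*} [NormedAddCommGroup EB] [NormedSpace ℝ EB]
  {HB : Type*} [TopologicalSpace HB] {IB : ModelWithCorners ℝ EB HB}
  {B : Type*} [TopologicalSpace B] [ChartedSpace HB B]
  {l : ℕ} {EF : Fin l → Type*} [∀ j, NormedAddCommGroup (EF j)] [∀ j, NormedSpace ℝ (EF j)]
  [∀ j, FiniteDimensional ℝ (EF j)]
  {HF : Fin l → Type*} [∀ j, TopologicalSpace (HF j)]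
  {IF : ∀ j, ModelWithCorners ℝ (EF j) (HF j)} [∀ j, (IF j).Boundaryless]
  {F : Fin l → Type*} [∀ j, TopologicalSpace (F j)] [∀ j, ChartedSpace (HF j) (F j)]

/-- The nullity of each of the fibre terms is upper semicontinuous. -/
theorem eventually_nullity_le [∀ j, IsManifold (IF j) ∞ (F j)]
    {gF : ∀ j, FormField (IF j) (F j)} {f : Fin l → B → ℝ}
    (hgF : ∀ j, IsSingularMetric (gF j)) (hf : ∀ j, ContMDiff IB 𝓘(ℝ, ℝ) ∞ (f j))
    (p : B × ∀ j, F j) (j : Fin l) :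
    ∀ᶠ q in 𝓝 p, nullity (gF j) ((f j q.1) ^ 2) (q.2 j) ≤
      nullity (gF j) ((f j p.1) ^ 2) (p.2 j) := by
  -- At a zero of `f j` the nullity already has its maximal value. Elsewhere the factor is nonzero
  -- nearby, and lower semicontinuity of the indices bounds the nullity from above.
  by_cases h0 : f j p.1 = 0
  · refine Filter.Eventually.of_forall fun q => ?_
    rw [h0, zero_pow two_ne_zero, nullity_zero]
    exact nullity_le_finrank _ _ _
  · have h1 : ∀ᶠ q : B × ∀ j, F j in 𝓝 p, f j q.1 ≠ 0 :=
      ((hf j).continuous.comp continuous_fst).continuousAt.eventually_ne h0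
    have hc : Continuous fun q : B × ∀ j, F j => q.2 j := by fun_prop
    filter_upwards [h1, (hc.tendsto p).eventually (eventually_signature_le (hgF j) (p.2 j))]
      with q hq hs
    have e1 := signature_add_nullity (hgF j) (pow_ne_zero 2 hq) (q.2 j)
    have e2 := signature_add_nullity (hgF j) (pow_ne_zero 2 h0) (p.2 j)
    omega

variable [IB.Boundaryless]

theorem finrank_ker_multiplyWarpedMetric {gB : FormField IB B} (hB : IsNondegenerate gB)
    (gF : ∀ j, FormField (IF j) (F j)) (f : Fin l → B → ℝ) (p : B × ∀ j, F j) :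
    Module.finrank ℝ (LinearMap.ker (multiplyWarpedMetric gB gF f p).toLinearMap) =
      ∑ j, nullity (gF j) ((f j p.1) ^ 2) (p.2 j) :=
  finrank_ker_warped (EB := EB) (EF := EF) (A := gB p.1) (C := fun j => gF j (p.2 j))
    (c := fun j => (f j p.1) ^ 2) (multiplyWarpedMetric_apply gB gF f p) (hB p.1)

variable [FiniteDimensional ℝ EB] [IsManifold IB ∞ B] [∀ j, IsManifold (IF j) ∞ (F j)]

/-- Where the signature of a multiply warped product is locally constant, each of its fibre terms
vanishes locally or has locally constant signature. -/
theorem ConstSignatureAt.of_multiplyWarpedMetric {gB : FormField IB B}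
    {gF : ∀ j, FormField (IF j) (F j)} {f : Fin l → B → ℝ} (hgB : IsSingularMetric gB)
    (hB : IsNondegenerate gB) (hgF : ∀ j, IsSingularMetric (gF j))
    (hf : ∀ j, ContMDiff IB 𝓘(ℝ, ℝ) ∞ (f j)) {p : B × ∀ j, F j}
    (h : ConstSignatureAt (multiplyWarpedMetric gB gF f) p) (j : Fin l) :
    (∀ᶠ b in 𝓝 p.1, f j b = 0) ∨ (∀ᶠ x in 𝓝 (p.2 j), gF j x = 0) ∨
      (f j p.1 ≠ 0 ∧ ConstSignatureAt (gF j) (p.2 j)) := by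
  have hg := isSingularMetric_multiplyWarpedMetric hgB hgF hf
  -- The product has locally constant rank, and the nullities of the fibre terms can only drop
  -- nearby; as their sum is constant, so is each of them.
  have hconst : ∀ᶠ q in 𝓝 p, nullity (gF j) ((f j q.1) ^ 2) (q.2 j) =
      nullity (gF j) ((f j p.1) ^ 2) (p.2 j) := by
    filter_upwards [h, Filter.eventually_all.2 (eventually_nullity_le hgF hf p)] with q hq hle
    have e1 := signature_add_finrank_ker hg q
    have e2 := signature_add_finrank_ker hg p
    rw [finrank_ker_multiplyWarpedMetric hB] at e1 e2
    refine (Finset.sum_eq_sum_iff_of_le fun j _ => hle j).1 ?_ j (Finset.mem_univ j)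
    omega
  -- Only the base point and the `j`-th fibre point are moved, independently of each other.
  have ht : Filter.Tendsto (fun z : B × F j => ((z.1, Function.update p.2 j z.2) : B × ∀ j, F j))
      (𝓝 p.1 ×ˢ 𝓝 (p.2 j)) (𝓝 p) := by
    rw [← nhds_prod_eq]
    have hc : Continuous fun z : B × F j => ((z.1, Function.update p.2 j z.2) : B × ∀ j, F j) :=
      continuous_fst.prodMk (continuous_const.update j continuous_snd)
    exact hc.tendsto' _ _ (by simp)
  have hprod : ∀ᶠ b in 𝓝 p.1, ∀ᶠ x in 𝓝 (p.2 j), nullity (gF j) ((f j b) ^ 2) x =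
      nullity (gF j) ((f j p.1) ^ 2) (p.2 j) := by
    filter_upwards [(ht.eventually hconst).curry] with b hb
    filter_upwards [hb] with x hx
    simpa only [Function.update_self] using hx
  by_cases h0 : f j p.1 = 0
  · rw [h0, zero_pow two_ne_zero, nullity_zero] at hprod
    by_cases hz : ∀ᶠ b in 𝓝 p.1, f j b = 0
    · exact Or.inl hz
    -- If `f j` vanishes at `p.1` but not nearby, some close `b` has `f j b ≠ 0`, while the nullity
    -- over `b` is still the full dimension for all `x` near `p.2 j`; hence `gF j` vanishes there.
    · obtain ⟨b, hb, hb'⟩ := ((Filter.not_eventually.1 hz).and_eventually hprod).exists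
      refine Or.inr (Or.inl ?_)
      filter_upwards [hb'] with x hx using eq_zero_of_nullity_eq (pow_ne_zero 2 hb) hx
  · refine Or.inr (Or.inr ⟨h0, constSignatureAt_of_eventually_add (hgF j) ?_⟩)
    filter_upwards [hprod.self_of_nhds] with x hx
    have e1 := signature_add_nullity (hgF j) (pow_ne_zero 2 h0) x
    have e2 := signature_add_nullity (hgF j) (pow_ne_zero 2 h0) (p.2 j)
    omega

end WarpedSignature

/-! ### Assembly of the proof -/

theorem ChartSemiRegular.congr {E : Type*} [NormedAddCommGroup E] [NormedSpace ℝ E]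
    {G G' : E → E →L[ℝ] E →L[ℝ] ℝ} {U S : Set E} (hU : IsOpen U) (hG : ∀ u ∈ U, G u = G' u)
    (h : ChartSemiRegular G U S) : ChartSemiRegular G' U S := by
  have hev : ∀ u ∈ U, G =ᶠ[𝓝 u] G' := fun u hu => by
    filter_upwards [hU.mem_nhds hu] with u' hu' using hG u' hu'
  have hc : ∀ u ∈ U, christoffel G' u = christoffel G u := fun u hu => by
    funext x y w
    rw [christoffel, christoffel, (hev u hu).fderiv_eq]
  have hd : ∀ u ∈ U, ∀ x y w, fderiv ℝ (fun u' => christoffel G' u' x y w) u =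
      fderiv ℝ (fun u' => christoffel G u' x y w) u := fun u hu x y w => by
    apply Filter.EventuallyEq.fderiv_eq
    filter_upwards [hU.mem_nhds hu] with u' hu'
    rw [hc u' hu']
  refine ⟨fun u hu => (h.smooth u hu).congr_of_eventuallyEq (hev u hu).symm,
    fun u hu => hG u hu ▸ h.symm u hu, fun u hu => ?_, fun x y z => ?_⟩
  · rw [hc u hu, ← hG u hu]
    exact h.christoffel_mem u hu
  · obtain ⟨r, h1, h2, h3⟩ := h.exists_extension x y z
    refine ⟨r, h1, fun u hu => hG u hu ▸ h2 u hu, fun u hu huS w => ?_⟩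
    rw [hc u hu, ← hG u hu, hd u hu]
    exact h3 u hu huS w

/-- A multiply warped product of semi-regular manifolds over a non-degenerate base is
semi-regular. -/
theorem isSemiRegular_multiplyWarpedMetric
    {EB : Type*} [NormedAddCommGroup EB] [NormedSpace ℝ EB] [FiniteDimensional ℝ EB]
    {HB : Type*} [TopologicalSpace HB] {IB : ModelWithCorners ℝ EB HB} [IB.Boundaryless]
    {B : Type*} [TopologicalSpace B] [T2Space B] [ChartedSpace HB B] [IsManifold IB ∞ B]
    {l : ℕ} {EF : Fin l → Type*} [∀ j, NormedAddCommGroup (EF j)] [∀ j, NormedSpace ℝ (EF j)]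
    [∀ j, FiniteDimensional ℝ (EF j)]
    {HF : Fin l → Type*} [∀ j, TopologicalSpace (HF j)]
    {IF : ∀ j, ModelWithCorners ℝ (EF j) (HF j)} [∀ j, (IF j).Boundaryless]
    {F : Fin l → Type*} [∀ j, TopologicalSpace (F j)] [∀ j, T2Space (F j)]
    [∀ j, ChartedSpace (HF j) (F j)] [∀ j, IsManifold (IF j) ∞ (F j)]
    (gB : FormField IB B) (gF : ∀ j, FormField (IF j) (F j))
    (f : Fin l → B → ℝ)
    (hgB : IsSingularMetric gB) (hB : IsNondegenerate gB)
    (hF : ∀ j, IsSemiRegular (gF j))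
    (hf : ∀ j, ContMDiff IB 𝓘(ℝ, ℝ) ∞ (f j)) :
    IsSemiRegular (multiplyWarpedMetric gB gF f) := by
  have hgF := fun j => (hF j).isSingularMetric
  refine isSemiRegular_of_chart (isSingularMetric_multiplyWarpedMetric hgB hgF hf) fun p => ?_
  choose UF hUF hpUF hUFt hreg using fun j => (hF j).exists_chartSemiRegular (p.2 j)
  have hUB := isOpen_extChartAt_target (I := IB) p.1
  have hsub : productDomain (extChartAt IB p.1).target UF ⊆
      (extChartAt (IB.prod (ModelWithCorners.pi IF)) p).target := fun u hu =>
    mem_extChartAt_warped_target.2 ⟨hu.1, fun j => hUFt j (hu.2 j)⟩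
  have hopen := isOpen_productDomain hUB hUF
  -- The base keeps its whole chart target; the fibres are restricted to the sets on which their
  -- cut-off coordinate fields are constant.
  refine ⟨_, hopen, ⟨mem_extChartAt_target p.1, hpUF⟩, hsub, ?_⟩
  refine ChartSemiRegular.congr hopen
    (fun u hu => (chartForm_multiplyWarpedMetric gB gF f (hsub hu)).symm)
    (chartSemiRegular_warpedForm hUB hUF (fun u hu => contDiffAt_chartForm hgB hu)
      (fun u _ => chartForm_symm hgB u) ?_ hreg (fun j u hu => contDiffAt_comp_symm hu (hf j _)) ?_)
  · intro u hu x hx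
    refine chartFrame_injective hu ?_
    rw [map_zero]
    refine hB _ _ fun y => ?_
    obtain ⟨w, rfl⟩ := chartFrame_surjective hu y
    exact hx w
  · intro u hu hS j
    have hcB := (continuousAt_extChartAt_symm'' hu.1).tendsto
    have hcF := (continuousAt_extChartAt_symm'' (hUFt j (hu.2 j))).tendsto
    rcases hS.of_multiplyWarpedMetric hgB hB hgF hf j with h | h | h
    · exact Or.inl (hcB.eventually h)
    · refine Or.inr (Or.inl ?_)
      filter_upwards [hcF.eventually h] with x hx
      refine ContinuousLinearMap.ext fun v => ContinuousLinearMap.ext fun w => ?_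
      rw [chartForm_apply, hx]
      rfl
    · exact Or.inr (Or.inr h)

end SingularGeometry

theorem theorem5p4
    {EB : Type*} [NormedAddCommGroup EB] [NormedSpace ℝ EB] [FiniteDimensional ℝ EB]
    {HB : Type*} [TopologicalSpace HB] {IB : ModelWithCorners ℝ EB HB} [IB.Boundaryless]
    {B : Type*} [TopologicalSpace B] [T2Space B] [ChartedSpace HB B] [IsManifold IB ∞ B]
    {l : ℕ} {EF : Fin l → Type*} [∀ j, NormedAddCommGroup (EF j)] [∀ j, NormedSpace ℝ (EF j)]
    [∀ j, FiniteDimensional ℝ (EF j)]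
    {HF : Fin l → Type*} [∀ j, TopologicalSpace (HF j)]
    {IF : ∀ j, ModelWithCorners ℝ (EF j) (HF j)} [∀ j, (IF j).Boundaryless]
    {F : Fin l → Type*} [∀ j, TopologicalSpace (F j)] [∀ j, T2Space (F j)]
    [∀ j, ChartedSpace (HF j) (F j)] [∀ j, IsManifold (IF j) ∞ (F j)]
    (gB : SingularGeometry.FormField IB B) (gF : ∀ j, SingularGeometry.FormField (IF j) (F j))
    (f : Fin l → B → ℝ)
    (hgB : SingularGeometry.IsSingularMetric gB) (hB : SingularGeometry.IsNondegenerate gB)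
    (hF : ∀ j, SingularGeometry.IsSemiRegular (gF j))
    (hf : ∀ j, ContMDiff IB 𝓘(ℝ, ℝ) ∞ (f j)) :
    SingularGeometry.IsSemiRegular (SingularGeometry.multiplyWarpedMetric gB gF f) :=
  SingularGeometry.isSemiRegular_multiplyWarpedMetric gB gF f hgB hB hF hf
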